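/- **Theorem 1.2 (First Main Theorem: zero order approximation).** For $k\in\mathbb N$ write $B\in C^k$ if $B:\mathbb R^3\to\mathbb R^3$ is $k$ times continuously differentiable and all its derivatives of order $0,\dots,k$ are bounded on $\mathbb R^3$; write $C^k_{\mathrm{loc}}$ if only $k$-fold continuous differentiability is required. Let $B\in C^2$ be nowhere vanishing with $\operatorname{div}B=0$, put $b:=B/|B|$, and fix $x_0,v_0\in\mathbb R^3$. For every $\omega>0$ the initial value problem $$\ddot x_\omega=\omega\,\dot x_\omega\times B(x_\omega),\qquad x_\omega(0)=x_0,\quad \dot x_\omega(0)=v_0$$ has a unique solution $x_\omega:\mathbb R\to\mathbb R^3$, and there is a curve $x\in C^3_{\mathrm{loc}}(\mathbb R,\mathbb R^3)$ with the following properties. 1. For every $0\le\alpha<1$, $x_\omega\to x$ in $C^{0,\alpha}_{\mathrm{loc}}$ as $\omega\to\infty$, that is, $\|x_\omega-x\|_{C^{0,\alpha}([0,T])}\to0$ for every $0<T<\infty$. 2. There is a function $h\in C^2_{\mathrm{loc}}(\mathbb R,\mathbb R)$ with $\dot x(t)=h(t)\,b(x(t))$ for all $t\in\mathbb R$. 3.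 If $\gamma\ge0$ and $B$ has minimal growth of order $\gamma$ at infinity, i.e. there are $R,c>0$ with $|B(y)|\ge c\,|y|^{-\gamma}$ for all $|y|\ge R$, then there is a constant $C>0$, independent of $t$ and $\omega$ (it may depend on $B,\gamma,x_0,v_0$), such that $$\|x_\omega-x\|_{C^0([0,t])}\le C\,\frac{\exp\left(C\exp\left(Ct^{\gamma+2}\right)\right)}{\omega}\qquad\text{for all }t\ge0,\ \omega>0.$$ 4. If in addition $B\in C^k_{\mathrm{loc}}$ for some $k\in\mathbb N$, then $x\in C^{k+1}_{\mathrm{loc}}$; and if $B$ is (real) analytic, then so is $x$. -/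

import Mathlib

open Set Filter Topology
open scoped NNReal ENNReal

namespace LorentzLimit

/-- Euclidean three-space, with its Euclidean norm. -/
abbrev E3 : Type := EuclideanSpace ℝ (Fin 3)

/-- The vector (cross) product of `ℝ³`. -/
noncomputable def cross (u v : E3) : E3 :=
  WithLp.toLp 2 (crossProduct (WithLp.ofLp u) (WithLp.ofLp v))

/-- The divergence `∑ i, ∂ᵢ Fᵢ` of a vector field. -/
noncomputable def divergence (F : E3 → E3) (y : E3) : ℝ :=
  ∑ i : Fin 3, (fderiv ℝ F y (EuclideanSpace.single i 1)) i

/-- `F ∈ C^k(ℝ³, ℝ³)`: `k` times continuously differentiable, with all derivatives of order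
`0, …, k` bounded on the whole space. (The local class `C^k_loc` is `ContDiff ℝ k F`.) -/
def BoundedCk (k : ℕ) (F : E3 → E3) : Prop :=
  ContDiff ℝ k F ∧ ∀ i : ℕ, i ≤ k → ∃ M : ℝ, ∀ y : E3, ‖iteratedFDeriv ℝ i F y‖ ≤ M

/-- The unit field `b = B / |B|`. -/
noncomputable def unitField (B : E3 → E3) (y : E3) : E3 := ‖B y‖⁻¹ • B y

/-- `B` has a minimal growth of order `γ` at infinity. -/
def HasMinimalGrowth (B : E3 → E3) (γ : ℝ) : Prop :=
  ∃ R C : ℝ, 0 < R ∧ 0 < C ∧ ∀ y : E3, R ≤ ‖y‖ → C / ‖y‖ ^ γ ≤ ‖B y‖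

/-- `ξ : ℝ → ℝ³` is a twice differentiable global solution of the initial value problem
`ξ'' = ω ξ' × B(ξ)`, `ξ(0) = x₀`, `ξ'(0) = v₀`. -/
def IsLorentzSolution (B : E3 → E3) (ω : ℝ) (x₀ v₀ : E3) (ξ : ℝ → E3) : Prop :=
  Differentiable ℝ ξ ∧
  (∀ t : ℝ, HasDerivAt (deriv ξ) (ω • cross (deriv ξ t) (B (ξ t))) t) ∧
  ξ 0 = x₀ ∧ deriv ξ 0 = v₀

/-- The `C^{0,α}([0,T])` norm, with values in `[0,∞]`: the supremum norm plus the
`α`-Hölder seminorm on `[0,T]`. -/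
noncomputable def holderNormOn (α : ℝ≥0) (T : ℝ) (f : ℝ → E3) : ℝ≥0∞ :=
  (⨆ t : Icc (0 : ℝ) T, ‖f t‖ₑ) + eHolderNorm α (fun t : Icc (0 : ℝ) T => f t)

/-- `X ω → x` in `C^{0,α}_loc` as `ω → ∞`: convergence in `C^{0,α}([0,T])` for every
`0 < T < ∞`. -/
def TendstoHolderLoc (α : ℝ≥0) (X : ℝ → ℝ → E3) (x : ℝ → E3) : Prop :=
  ∀ T : ℝ, 0 < T → Tendsto (fun ω : ℝ => holderNormOn α T (fun t => X ω t - x t)) atTop (𝓝 0)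

end LorentzLimit

open LorentzLimit

/-! For large ω the velocity v of the particle turns rapidly about b, while |v| = |v₀| is conserved.
Two slow quantities survive, and each has a correction of order 1/ω after which its derivative no
longer contains ω.

Subtracting ω⁻¹ (B/|B|²) × v from the position gives the guiding centre. By b × (v × b) = v - ⟨b, v⟩
b its velocity is ⟨b, v⟩ b + O(1/ω) (`hasDerivAt_guidingCenter`). The parallel velocity u = ⟨b, v⟩
satisfies u' = ⟨Db v, v⟩, because the force is orthogonal to b. As Db takes values in the plane
orthogonal to b, its trace on that plane is div b, so this quadratic form has mean ½ (|v₀|² - u²)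
div b over one gyration. The remainder is the derivative of `gyroForm` along the gyration
(`gyroForm_gyration`), so subtracting ω⁻¹ `gyroForm` removes it up to O(1/ω)
(`hasDerivAt_parallelVelocity`).

The limit thus solves x' = h b(x), h' = ½ (|v₀|² - h²) div b(x). Grönwall's inequality for the
corrected differences gives `exists_rate_estimate`: an error Q exp(QT)/ω, where Q is a multiple of a
power of a bound for 1 + 1/|B| on the ball reached by time T. Under minimal growth Q is polynomial
in T, and the double exponential dominates. Hölder convergence interpolates between this rate and a
Lipschitz bound uniform in ω. Regularity is that of integral curves, with analyticity from the
analytic implicit function theorem. -/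

/-! ### Global existence, uniqueness and smoothness of integral curves. -/

section ODE

variable {E : Type*} [NormedAddCommGroup E] [NormedSpace ℝ E]

-- Lets the theorems on integral curves in manifolds, namely uniqueness and gluing, be applied to an
-- ODE in `E`.
open scoped Manifold in
theorem contMDiff_section_of_contDiff {F : E → E} (hF : ContDiff ℝ 1 F) :
    ContMDiff 𝓘(ℝ, E) 𝓘(ℝ, E).tangent 1 (fun x => (⟨x, F x⟩ : TangentBundle 𝓘(ℝ, E) E)) := by
  intro x
  exact contMDiffAt_vectorSpace_iff_contDiffAt.2 hF.contDiffAt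

open scoped Manifold in
theorem ODE_global_solution_unique [CompleteSpace E] {F : E → E} (hF : ContDiff ℝ 1 F)
    {y z : ℝ → E} (hy : ∀ t, HasDerivAt y (F (y t)) t) (hz : ∀ t, HasDerivAt z (F (z t)) t)
    (h0 : y 0 = z 0) : y = z :=
  isMIntegralCurve_Ioo_eq_of_contMDiff_boundaryless (I := 𝓘(ℝ, E)) (v := F)
    (contMDiff_section_of_contDiff hF)
    (fun t => (hy t).hasFDerivAt.hasMFDerivAt) (fun t => (hz t).hasFDerivAt.hasMFDerivAt) h0

open scoped Manifold in
theorem exists_global_of_exists_Ioo [CompleteSpace E] {F : E → E} (hF : ContDiff ℝ 1 F) (y₀ : E)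
    (h : ∀ T : ℝ, ∃ y : ℝ → E, y 0 = y₀ ∧ ∀ t ∈ Ioo (-T) T, HasDerivAt y (F (y t)) t) :
    ∃ y : ℝ → E, y 0 = y₀ ∧ ∀ t, HasDerivAt y (F (y t)) t := by
  obtain ⟨y, hy0, hy⟩ := (exists_isMIntegralCurve_iff_exists_isMIntegralCurveOn_Ioo
    (I := 𝓘(ℝ, E)) (v := F) (contMDiff_section_of_contDiff hF) y₀).2 (fun T => by
      obtain ⟨y, hy0, hy⟩ := h T
      exact ⟨y, hy0, fun t ht => (hy t ht).hasFDerivAt.hasMFDerivAt.hasMFDerivWithinAt⟩)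
  exact ⟨y, hy0, fun t => (hy t).hasFDerivAt⟩

/-- A compactly supported `C¹` vector field has integral curves on every interval. -/
theorem exists_Ioo_solution_of_hasCompactSupport [CompleteSpace E] {F : E → E}
    (hF : ContDiff ℝ 1 F) (hc : HasCompactSupport F) (y₀ : E) {T : ℝ} (hT : 0 < T) :
    ∃ y : ℝ → E, y 0 = y₀ ∧ ∀ t ∈ Ioo (-T) T, HasDerivAt y (F (y t)) t := by
  obtain ⟨K, hK⟩ := hF.lipschitzWith_of_hasCompactSupport hc one_ne_zero
  obtain ⟨L, hL⟩ := hc.exists_bound_of_continuous hF.continuous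
  have h0 : (0 : ℝ) ∈ Icc (-T) T := ⟨by linarith, hT.le⟩
  have hpl : IsPicardLindelof (fun _ : ℝ => F) (tmin := -T) (tmax := T) ⟨0, h0⟩ y₀
      (L.toNNReal * T.toNNReal) 0 L.toNNReal K := by
    refine .of_time_independent (fun x _ => (hL x).trans (Real.le_coe_toNNReal L))
      (hK.lipschitzOnWith) ?_
    simp [hT.le]
  obtain ⟨y, hy0, hy⟩ := hpl.exists_eq_forall_mem_Icc_hasDerivWithinAt₀
  exact ⟨y, hy0, fun t ht => (hy t (Ioo_subset_Icc_self ht)).hasDerivAt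
    (Icc_mem_nhds ht.1 ht.2)⟩

/-- A vector field `(F₁, F₂)` on `E × V` with `F₂ (x, v) ⟂ v` and `‖F₁ (x, v)‖ ≤ ‖v‖` is complete,
and the norm of the second component is conserved. -/
theorem exists_global_solution_of_conserved {V : Type*} [FiniteDimensional ℝ E]
    [NormedAddCommGroup V] [InnerProductSpace ℝ V] [FiniteDimensional ℝ V]
    {F : E × V → E × V} (hF : ContDiff ℝ 1 F) (h1 : ∀ z, ‖(F z).1‖ ≤ ‖z.2‖)
    (h2 : ∀ z, inner ℝ z.2 (F z).2 = 0) (z₀ : E × V) :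
    ∃ z : ℝ → E × V, z 0 = z₀ ∧ (∀ t, HasDerivAt z (F (z t)) t) ∧
      (∀ t, ‖(z t).2‖ = ‖z₀.2‖) ∧ ∀ t, ‖(z t).1 - z₀.1‖ ≤ ‖z₀.2‖ * |t| := by
  -- A scalar factor χ with values in [0, 1] spoils neither orthogonality nor the speed bound, so
  -- one a priori estimate serves both the truncated field and `F` itself (χ = 1).
  have key : ∀ (T : ℝ) (χ : E × V → ℝ) (z : ℝ → E × V), (∀ y, 0 ≤ χ y) → (∀ y, χ y ≤ 1) →
      z 0 = z₀ → (∀ t ∈ Ioo (-T) T, HasDerivAt z (χ (z t) • F (z t)) t) →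
      ∀ t ∈ Ioo (-T) T, ‖(z t).2‖ = ‖z₀.2‖ ∧ ‖(z t).1 - z₀.1‖ ≤ ‖z₀.2‖ * |t| := by
    intro T χ z hχ0 hχ1 hz0 hz
    have hz1 : ∀ t ∈ Ioo (-T) T, HasDerivAt (fun s => (z s).1) (χ (z t) • (F (z t)).1) t := by
      intro t ht
      exact (ContinuousLinearMap.fst ℝ E V).hasFDerivAt.comp_hasDerivAt t (hz t ht)
    have hz2 : ∀ t ∈ Ioo (-T) T, HasDerivAt (fun s => (z s).2) (χ (z t) • (F (z t)).2) t := by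
      intro t ht
      exact (ContinuousLinearMap.snd ℝ E V).hasFDerivAt.comp_hasDerivAt t (hz t ht)
    have hn : ∀ t ∈ Ioo (-T) T, ‖(z t).2‖ = ‖z₀.2‖ := by
      intro t ht
      have h0 : (0 : ℝ) ∈ Ioo (-T) T := by
        have := ht.1.trans ht.2
        constructor <;> linarith
      have hd : ∀ s ∈ Ioo (-T) T, HasDerivAt (fun s => ‖(z s).2‖ ^ 2) 0 s := by
        intro s hs
        have := (hz2 s hs).norm_sq
        rwa [inner_smul_right, h2, mul_zero, mul_zero] at this
      have := isOpen_Ioo.is_const_of_deriv_eq_zero isPreconnected_Ioo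
        (fun s hs => (hd s hs).differentiableAt.differentiableWithinAt)
        (fun s hs => (hd s hs).deriv) ht h0
      simp only [hz0] at this
      exact (sq_eq_sq₀ (norm_nonneg _) (norm_nonneg _)).1 this
    intro t ht
    refine ⟨hn t ht, ?_⟩
    have h0 : (0 : ℝ) ∈ Ioo (-T) T := by
      have := ht.1.trans ht.2
      constructor <;> linarith
    have := (convex_Ioo (-T) T).norm_image_sub_le_of_norm_hasDerivWithin_le
      (fun s hs => (hz1 s hs).hasDerivWithinAt) (C := ‖z₀.2‖) (fun s hs => by
        rw [norm_smul, Real.norm_of_nonneg (hχ0 _), ← hn s hs]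
        calc χ (z s) * ‖(F (z s)).1‖ ≤ 1 * ‖(z s).2‖ := by
              gcongr
              · exact hχ1 _
              · exact h1 _
          _ = _ := one_mul _) h0 ht
    simpa [hz0] using this
  obtain ⟨z, hz0, hz⟩ : ∃ z : ℝ → E × V, z 0 = z₀ ∧ ∀ t, HasDerivAt z (F (z t)) t := by
    have : CompleteSpace E := FiniteDimensional.complete ℝ E
    have : CompleteSpace V := FiniteDimensional.complete ℝ V
    refine exists_global_of_exists_Ioo hF z₀ fun T => ?_
    rcases le_or_gt T 0 with hT | hT
    · exact ⟨fun _ => z₀, rfl, fun t ht => absurd (ht.1.trans ht.2) (by linarith)⟩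
    -- Up to time `T` the first component moves by at most ‖z₀.2‖ T and the second by at most 2
    -- ‖z₀.2‖, so the solution never leaves the ball where the cutoff equals 1.
    set r : ℝ := ‖z₀.2‖ * T + 2 * ‖z₀.2‖ + 1
    have hr : 0 < r := by positivity
    let χ : ContDiffBump z₀ := ⟨r, r + 1, hr, by linarith⟩
    have hχc : ContDiff ℝ 1 (fun y => χ y • F y) := χ.contDiff.smul hF
    obtain ⟨z, hz0, hz⟩ := exists_Ioo_solution_of_hasCompactSupport hχc
      (χ.hasCompactSupport.smul_right) z₀ hT
    have hk := key T χ z (fun _ => χ.nonneg) (fun _ => χ.le_one) hz0 hz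
    refine ⟨z, hz0, fun t ht => ?_⟩
    have := hz t ht
    rwa [χ.one_of_mem_closedBall, one_smul] at this
    rw [mem_closedBall_iff_norm, Prod.norm_def, max_le_iff]
    obtain ⟨ha, hb⟩ := hk t ht
    constructor
    · refine hb.trans ?_
      have : |t| ≤ T := abs_le.2 ⟨ht.1.le, ht.2.le⟩
      have := mul_le_mul_of_nonneg_left this (norm_nonneg z₀.2)
      have := norm_nonneg z₀.2
      change _ ≤ ‖z₀.2‖ * T + 2 * ‖z₀.2‖ + 1
      linarith
    · refine (norm_sub_le _ _).trans ?_
      rw [ha]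
      have : 0 ≤ ‖z₀.2‖ * T := by positivity
      change _ ≤ ‖z₀.2‖ * T + 2 * ‖z₀.2‖ + 1
      linarith
  have hk := fun t : ℝ => key (|t| + 1) (fun _ => 1) z (fun _ => zero_le_one) (fun _ => le_rfl) hz0
    (fun s _ => by simpa using hz s) t
    (abs_lt.1 (lt_add_one _))
  exact ⟨z, hz0, hz, fun t => (hk t).1, fun t => (hk t).2⟩

/-- An integral curve of a `Cⁿ` vector field is `Cⁿ⁺¹`. -/
theorem contDiff_succ_of_hasDerivAt {F : E → E} {n : ℕ} (hF : ContDiff ℝ n F) {y : ℝ → E}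
    (hy : ∀ t, HasDerivAt y (F (y t)) t) : ContDiff ℝ (n + 1) y := by
  have hd : deriv y = F ∘ y := funext fun t => (hy t).deriv
  have hdiff : Differentiable ℝ y := fun t => (hy t).differentiableAt
  induction n with
  | zero =>
    refine contDiff_succ_iff_deriv.2 ⟨hdiff, by simp, ?_⟩
    rw [hd]
    exact hF.comp (contDiff_zero.2 hdiff.continuous)
  | succ n ih =>
    refine contDiff_succ_iff_deriv.2 ⟨hdiff, by simp, ?_⟩
    rw [hd]
    have := ih (hF.of_le (by exact_mod_cast Nat.le_succ n))
    exact hF.comp (by exact_mod_cast this)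

end ODE

/-! ### Analyticity of integral curves of analytic fields. -/

section AnalyticODE

open scoped ContDiff

variable {E : Type*} [NormedAddCommGroup E] [NormedSpace ℝ E]

/-- Pointwise evaluation of a continuous multilinear map on continuous functions. -/
noncomputable def multilinearNemytskii (K : Type*) [TopologicalSpace K] [CompactSpace K] {n : ℕ}
    (p : ContinuousMultilinearMap ℝ (fun _ : Fin n => E) E) :
    ContinuousMultilinearMap ℝ (fun _ : Fin n => C(K, E)) C(K, E) :=
  MultilinearMap.mkContinuous
    { toFun := fun f => ⟨fun t => p fun i => f i t, by fun_prop⟩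
      map_update_add' := by
        intro _ f i x y
        ext t
        have h : ∀ z : C(K, E), (fun j => (Function.update f i z j) t) =
            Function.update (fun j => f j t) i (z t) := by
          intro z
          ext j
          by_cases hj : j = i
          · subst hj; simp
          · simp [hj]
        simp only [ContinuousMap.coe_mk, ContinuousMap.add_apply]
        rw [h, h, h]
        simp
      map_update_smul' := by
        intro _ f i c x
        ext t
        have h : ∀ z : C(K, E), (fun j => (Function.update f i z j) t) =
            Function.update (fun j => f j t) i (z t) := by
          intro z
          ext j
          by_cases hj : j = i
          · subst hj; simp
          · simp [hj]
        simp only [ContinuousMap.coe_mk, ContinuousMap.smul_apply]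
        rw [h, h]
        simp }
    ‖p‖ (fun f => by
      refine (ContinuousMap.norm_le _ (by positivity)).2 fun t => ?_
      refine (p.le_opNorm _).trans ?_
      gcongr with i
      exact (f i).norm_coe_le_norm t)

theorem norm_multilinearNemytskii_le (K : Type*) [TopologicalSpace K] [CompactSpace K] {n : ℕ}
    (p : ContinuousMultilinearMap ℝ (fun _ : Fin n => E) E) :
    ‖multilinearNemytskii K p‖ ≤ ‖p‖ :=
  MultilinearMap.mkContinuous_norm_le _ (norm_nonneg _) _

/-- The superposition operator of a function analytic at `q` is analytic at the constant
function `q`. -/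
theorem analyticAt_nemytskii [CompleteSpace E] (K : Type*) [TopologicalSpace K] [CompactSpace K]
    {F : E → E} (hFc : Continuous F) {q : E} (hF : AnalyticAt ℝ F q) :
    AnalyticAt ℝ (fun f : C(K, E) => (⟨F, hFc⟩ : C(E, E)).comp f) (ContinuousMap.const K q) := by
  obtain ⟨P, r, hP⟩ := hF
  obtain ⟨r', hr'0, hr'⟩ := ENNReal.lt_iff_exists_nnreal_btwn.1 hP.r_pos
  have hr'0' : 0 < (r' : ℝ≥0∞) := by exact_mod_cast hr'0
  let N : FormalMultilinearSeries ℝ C(K, E) C(K, E) := fun n => multilinearNemytskii K (P n)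
  have hNr : (r' : ℝ≥0∞) ≤ N.radius := by
    refine FormalMultilinearSeries.le_radius_of_bound N
      (P.norm_mul_pow_le_of_lt_radius (hr'.trans_le hP.r_le)).choose fun n => ?_
    refine le_trans ?_
      ((P.norm_mul_pow_le_of_lt_radius (hr'.trans_le hP.r_le)).choose_spec.2 n)
    gcongr
    exact norm_multilinearNemytskii_le K (P n)
  refine ⟨N, r', hNr, hr'0', ?_⟩
  intro f hf
  have hs : Summable fun n => N n fun _ => f :=
    N.summable (Metric.eball_subset_eball hNr hf)
  have hval : ∑' n, N n (fun _ => f) = (⟨F, hFc⟩ : C(E, E)).comp (ContinuousMap.const K q + f) := by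
    ext t
    have h1 := (ContinuousMap.hasSum_apply hs.hasSum t)
    have hft : f t ∈ Metric.eball (0 : E) r := by
      rw [Metric.mem_eball, edist_zero_right] at hf ⊢
      refine lt_of_le_of_lt ?_ (hf.trans hr')
      rw [enorm_le_iff_norm_le]
      exact f.norm_coe_le_norm t
    exact h1.unique (hP.hasSum hft)
  rw [← hval]
  exact hs.hasSum

/-- The primitive vanishing at `0`, as a bounded operator on `C([0,1], E)`. -/
noncomputable def primitiveL [CompleteSpace E] : C(unitInterval, E) →L[ℝ] C(unitInterval, E) :=
  LinearMap.mkContinuous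
    { toFun := fun f => ⟨fun s => ∫ τ in (0 : ℝ)..s, f (projIcc 0 1 zero_le_one τ), by
        have hc : Continuous fun τ : ℝ => f (projIcc 0 1 zero_le_one τ) :=
          f.continuous.comp continuous_projIcc
        exact (intervalIntegral.continuous_primitive
          (fun a b => hc.intervalIntegrable a b) 0).comp continuous_subtype_val⟩
      map_add' := by
        intro f g
        ext s
        have hc : ∀ f : C(unitInterval, E), Continuous fun τ : ℝ => f (projIcc 0 1 zero_le_one τ) :=
          fun f => f.continuous.comp continuous_projIcc
        exact intervalIntegral.integral_add ((hc f).intervalIntegrable _ _)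
          ((hc g).intervalIntegrable _ _)
      map_smul' := by
        intro c f
        ext s
        exact intervalIntegral.integral_smul c _ }
    1 (fun f => by
      refine (ContinuousMap.norm_le _ (by positivity)).2 fun s => ?_
      refine (intervalIntegral.norm_integral_le_of_norm_le_const (C := ‖f‖)
        (fun τ _ => f.norm_coe_le_norm _)).trans ?_
      rw [sub_zero, abs_of_nonneg s.2.1, one_mul]
      exact mul_le_of_le_one_right (norm_nonneg _) s.2.2)

theorem primitiveL_apply [CompleteSpace E] (f : C(unitInterval, E)) (s : unitInterval) :
    primitiveL f s = ∫ τ in (0 : ℝ)..s, f (projIcc 0 1 zero_le_one τ) := rfl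

/-- Integral curves of an analytic vector field are analytic. -/
theorem analyticOnNhd_of_hasDerivAt [CompleteSpace E] {F : E → E} (hF : AnalyticOnNhd ℝ F univ)
    {y : ℝ → E} (hy : ∀ t, HasDerivAt y (F (y t)) t) : AnalyticOnNhd ℝ y univ := by
  intro t₀ _
  have hFc : Continuous F := continuousOn_univ.1 hF.continuousOn
  have hyc : Continuous y := continuous_iff_continuousAt.2 fun t => (hy t).continuousAt
  set q := y t₀ with hq
  let c : C(unitInterval, E) := ContinuousMap.const _ q
  -- The zeros of Φ(ε, ·) are the solutions of the integral equation for s ↦ y(t₀ + ε s). Rescaling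
  -- time turns its length into a parameter, on which the implicit function depends analytically.
  let Φ : ℝ × C(unitInterval, E) → C(unitInterval, E) := fun u =>
    u.2 - u.1 • primitiveL ((⟨F, hFc⟩ : C(E, E)).comp u.2) - c
  let u₀ : ℝ × C(unitInterval, E) := (0, c)
  have hN : ContDiffAt ℝ ω (fun u : ℝ × C(unitInterval, E) =>
      (⟨F, hFc⟩ : C(E, E)).comp u.2) u₀ := by
    have := (analyticAt_nemytskii unitInterval hFc (hF q (mem_univ _))).contDiffAt (n := ω)
    exact ContDiffAt.comp (g := fun f : C(unitInterval, E) => (⟨F, hFc⟩ : C(E, E)).comp f)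
      u₀ this contDiffAt_snd
  have hΦ : ContDiffAt ℝ ω Φ u₀ :=
    (contDiffAt_snd.sub (contDiffAt_fst.smul
      ((primitiveL (E := E)).contDiff.contDiffAt.comp u₀ hN))).sub contDiffAt_const
  have hωne : (ω : WithTop ℕ∞) ≠ 0 := by simp
  -- At ε = 0 the integral term drops out and Φ(0, f) = f - c.
  have hinv : (fderiv ℝ Φ u₀ ∘L .inr ℝ ℝ C(unitInterval, E)) =
      ContinuousLinearMap.id ℝ C(unitInterval, E) := by
    have h1 : HasFDerivAt (fun f : C(unitInterval, E) => Φ (0, f))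
        (fderiv ℝ Φ u₀ ∘L .inr ℝ ℝ C(unitInterval, E)) c :=
      HasFDerivAt.comp (f := fun f : C(unitInterval, E) => ((0 : ℝ), f)) c
        (hΦ.differentiableAt hωne).hasFDerivAt (hasFDerivAt_prodMk_right (0 : ℝ) c)
    have h2 : HasFDerivAt (fun f : C(unitInterval, E) => Φ (0, f))
        (ContinuousLinearMap.id ℝ C(unitInterval, E)) c := by
      have : (fun f : C(unitInterval, E) => Φ (0, f)) = fun f => f - c := by
        ext1 f
        simp [Φ]
      rw [this]
      exact (hasFDerivAt_id c).sub_const c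
    exact h1.unique h2
  have hinvt : (fderiv ℝ Φ u₀ ∘L .inr ℝ ℝ C(unitInterval, E)).IsInvertible := by
    rw [hinv]
    exact ⟨ContinuousLinearEquiv.refl ℝ _, rfl⟩
  let G : C(ℝ × unitInterval, E) := ⟨fun z => y (t₀ + z.1 * z.2), by fun_prop⟩
  let Y : ℝ → C(unitInterval, E) := G.curry
  have hYc : Continuous Y := G.curry.continuous
  have hY0 : Y 0 = c := by
    ext s
    simp [Y, G, c, hq]
  have hΦu : Φ u₀ = 0 := by simp [Φ, u₀]
  have hΦY : ∀ ε, Φ (ε, Y ε) = 0 := by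
    intro ε
    ext s
    have hd : ∀ τ : ℝ, HasDerivAt (fun τ => y (t₀ + ε * τ)) (ε • F (y (t₀ + ε * τ))) τ := by
      intro τ
      have h1 : HasDerivAt (fun τ : ℝ => t₀ + ε * τ) ε τ := by
        simpa using ((hasDerivAt_id τ).const_mul ε).const_add t₀
      exact (hy (t₀ + ε * τ)).scomp τ h1
    have hint := intervalIntegral.integral_eq_sub_of_hasDerivAt (a := 0) (b := (s : ℝ))
      (fun τ _ => hd τ) (Continuous.intervalIntegrable (by fun_prop) _ _)
    rw [intervalIntegral.integral_smul] at hint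
    have hcongr : primitiveL ((⟨F, hFc⟩ : C(E, E)).comp (Y ε)) s =
        ∫ τ in (0 : ℝ)..s, F (y (t₀ + ε * τ)) := by
      rw [primitiveL_apply]
      refine intervalIntegral.integral_congr fun τ hτ => ?_
      rw [uIcc_of_le s.2.1] at hτ
      have hτ' : τ ∈ Icc (0 : ℝ) 1 := ⟨hτ.1, hτ.2.trans s.2.2⟩
      simp only [ContinuousMap.comp_apply, projIcc_of_mem zero_le_one hτ']
      rfl
    change Y ε s - ε • primitiveL ((⟨F, hFc⟩ : C(E, E)).comp (Y ε)) s - q = 0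
    rw [hcongr, hint]
    change y (t₀ + ε * s) - _ - q = 0
    simp [hq]
  -- Local uniqueness in the implicit function theorem identifies its solution with the given curve.
  have hev : ∀ᶠ ε in 𝓝 (0 : ℝ), hΦ.implicitFunction hωne hinvt ε = Y ε := by
    have h1 := hΦ.eventually_apply_eq_iff_implicitFunction hωne hinvt
    have h2 : Tendsto (fun ε => (ε, Y ε)) (𝓝 0) (𝓝 u₀) := by
      have : Continuous fun ε => (ε, Y ε) := by fun_prop
      simpa [u₀, hY0] using this.tendsto 0
    filter_upwards [h2.eventually h1] with ε hε
    exact hε.1 (by rw [hΦY, hΦu])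
  have hYan : ContDiffAt ℝ ω Y 0 :=
    (hΦ.contDiffAt_implicitFunction hωne hinvt).congr_of_eventuallyEq
      (hev.mono fun _ h => h.symm)
  have hev1 : ContDiff ℝ ω (fun f : C(unitInterval, E) => f 1) :=
    (ContinuousMap.evalCLM ℝ (1 : unitInterval) : C(unitInterval, E) →L[ℝ] E).contDiff
  have h1 : ContDiffAt ℝ ω (fun ε => Y ε 1) 0 :=
    hev1.contDiffAt.comp (0 : ℝ) hYan
  have h2 : ContDiffAt ℝ ω y t₀ := by
    -- Evaluation at s = 1 is continuous and linear and returns y(t₀ + ε).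
    have h3 : (fun t => (fun ε => Y ε 1) (t - t₀)) = y := by
      ext t
      simp [Y, G]
    rw [← h3]
    refine ContDiffAt.comp (g := fun ε => Y ε 1) t₀ (by simpa using h1)
      (contDiffAt_id.sub contDiffAt_const)
  exact h2.analyticAt

end AnalyticODE

/-! ### Functions bounded, with their derivative, by powers of a weight. -/

section Tame

variable {E F G H : Type*} [NormedAddCommGroup E] [NormedSpace ℝ E]
  [NormedAddCommGroup F] [NormedSpace ℝ F] [NormedAddCommGroup G] [NormedSpace ℝ G]
  [NormedAddCommGroup H] [NormedSpace ℝ H]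

/-- `f` is bounded by a multiple of a power of the weight `W`. -/
def PolyBounded (W : E → ℝ) (f : E → F) : Prop :=
  ∃ (C : ℝ) (p : ℕ), 0 ≤ C ∧ ∀ x, ‖f x‖ ≤ C * W x ^ p

/-- `f` is differentiable, and `f` and its derivative are bounded by multiples of powers of the
weight `W`. -/
structure Tame (W : E → ℝ) (f : E → F) : Prop where
  differentiable : Differentiable ℝ f
  bound : PolyBounded W f
  bound_fderiv : PolyBounded W (fderiv ℝ f)

variable {W : E → ℝ} (hW : ∀ x, 1 ≤ W x)

omit [NormedSpace ℝ E] [NormedSpace ℝ F] in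
theorem PolyBounded.of_bound {f : E → F} {M : ℝ} (h : ∀ x, ‖f x‖ ≤ M) : PolyBounded W f :=
  ⟨M, 0, (norm_nonneg _).trans (h 0), by simpa using h⟩

omit [NormedAddCommGroup E] [NormedSpace ℝ E] [NormedSpace ℝ F] in
include hW in
theorem PolyBounded.add {f g : E → F} (hf : PolyBounded W f) (hg : PolyBounded W g) :
    PolyBounded W (fun x => f x + g x) := by
  obtain ⟨C, p, hC, hf⟩ := hf
  obtain ⟨D, q, hD, hg⟩ := hg
  refine ⟨C + D, p + q, by positivity, fun x => (norm_add_le _ _).trans ?_⟩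
  have h1 : W x ^ p ≤ W x ^ (p + q) := pow_le_pow_right₀ (hW x) (Nat.le_add_right _ _)
  have h2 : W x ^ q ≤ W x ^ (p + q) := pow_le_pow_right₀ (hW x) (Nat.le_add_left _ _)
  have h3 := hf x
  have h4 := hg x
  nlinarith [mul_le_mul_of_nonneg_left h1 hC, mul_le_mul_of_nonneg_left h2 hD]

omit [NormedAddCommGroup E] [NormedSpace ℝ E] in
theorem PolyBounded.bilin (L : F →L[ℝ] G →L[ℝ] H) {f : E → F} {g : E → G}
    (hf : PolyBounded W f) (hg : PolyBounded W g) : PolyBounded W (fun x => L (f x) (g x)) := by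
  obtain ⟨C, p, hC, hf⟩ := hf
  obtain ⟨D, q, hD, hg⟩ := hg
  refine ⟨‖L‖ * (C * D), p + q, by positivity, fun x => (L.le_opNorm₂ _ _).trans ?_⟩
  calc ‖L‖ * ‖f x‖ * ‖g x‖ ≤ ‖L‖ * (C * W x ^ p) * (D * W x ^ q) := by
        gcongr
        · have := (norm_nonneg _).trans (hf x)
          positivity
        · exact hf x
        · exact hg x
    _ = _ := by ring

theorem Tame.const (a : F) : Tame W (fun _ => a) :=
  ⟨differentiable_const a, .of_bound fun _ => le_rfl, .of_bound (M := 0) fun x => by simp⟩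

include hW in
theorem Tame.add {f g : E → F} (hf : Tame W f) (hg : Tame W g) : Tame W (fun x => f x + g x) := by
  refine ⟨hf.1.add hg.1, hf.2.add hW hg.2, ?_⟩
  have : fderiv ℝ (fun x => f x + g x) = fun x => fderiv ℝ f x + fderiv ℝ g x :=
    funext fun x => fderiv_fun_add (hf.1 x) (hg.1 x)
  rw [this]
  exact hf.3.add hW hg.3

theorem fderiv_bilin (L : F →L[ℝ] G →L[ℝ] H) {f : E → F} {g : E → G}
    (hf : Differentiable ℝ f) (hg : Differentiable ℝ g) :
    fderiv ℝ (fun x => L (f x) (g x)) = fun x =>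
      L.precompR E (f x) (fderiv ℝ g x) + L.precompL E (fderiv ℝ f x) (g x) :=
  funext fun x => L.fderiv_of_bilinear (hf x) (hg x)

-- Scalar multiplication, composition, evaluation, inner and cross product are all bilinear, so this
-- closure property covers every coefficient below.
include hW in
theorem Tame.bilin (L : F →L[ℝ] G →L[ℝ] H) {f : E → F} {g : E → G}
    (hf : Tame W f) (hg : Tame W g) : Tame W (fun x => L (f x) (g x)) := by
  refine ⟨fun x => (L.hasFDerivAt_of_bilinear (hf.1 x).hasFDerivAt
    (hg.1 x).hasFDerivAt).differentiableAt, .bilin L hf.2 hg.2, ?_⟩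
  rw [fderiv_bilin L hf.1 hg.1]
  exact (PolyBounded.bilin _ hf.2 hg.3).add hW (.bilin _ hf.3 hg.2)

include hW in
theorem Tame.fderiv_bilin (L : F →L[ℝ] G →L[ℝ] H) {f : E → F} {g : E → G}
    (hf : Tame W f) (hg : Tame W g) (hf' : Tame W (fderiv ℝ f)) (hg' : Tame W (fderiv ℝ g)) :
    Tame W (fderiv ℝ (fun x => L (f x) (g x))) := by
  rw [_root_.fderiv_bilin L hf.1 hg.1]
  exact (Tame.bilin hW _ hf hg').add hW (.bilin hW _ hf' hg)

include hW in
theorem Tame.clm (L : F →L[ℝ] G) {f : E → F} (hf : Tame W f) : Tame W (fun x => L (f x)) :=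
  Tame.bilin hW (ContinuousLinearMap.id ℝ (F →L[ℝ] G)) (Tame.const L) hf

include hW in
theorem Tame.smul {ρ : E → ℝ} {f : E → F} (hρ : Tame W ρ) (hf : Tame W f) :
    Tame W (fun x => ρ x • f x) :=
  Tame.bilin hW (ContinuousLinearMap.lsmul ℝ ℝ) hρ hf

include hW in
theorem Tame.clm_comp {f : E → G →L[ℝ] H} {g : E → F →L[ℝ] G} (hf : Tame W f) (hg : Tame W g) :
    Tame W (fun x => (f x).comp (g x)) :=
  Tame.bilin hW (ContinuousLinearMap.compL ℝ F G H) hf hg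

include hW in
theorem Tame.clm_apply {f : E → G →L[ℝ] H} {g : E → G} (hf : Tame W f) (hg : Tame W g) :
    Tame W (fun x => f x (g x)) :=
  Tame.bilin hW (ContinuousLinearMap.id ℝ (G →L[ℝ] H)) hf hg

end Tame

/-! ### Vector algebra of the gyration. -/

section Field

/-- The cross product as a continuous bilinear map. -/
noncomputable def crossL : E3 →L[ℝ] E3 →L[ℝ] E3 :=
  LinearMap.toContinuousBilinearMap <| LinearMap.mk₂ ℝ cross
    (fun a b c => by ext i; fin_cases i <;> simp [cross, cross_apply])
    (fun a b c => by ext i; fin_cases i <;> simp [cross, cross_apply])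
    (fun a b c => by ext i; fin_cases i <;> simp [cross, cross_apply] <;> ring)
    (fun a b c => by ext i; fin_cases i <;> simp [cross, cross_apply])

theorem crossL_apply (u v : E3) : crossL u v = cross u v := rfl

/-- The trace of a continuous endomorphism of `ℝ³`. -/
noncomputable def traceL : (E3 →L[ℝ] E3) →L[ℝ] ℝ :=
  ∑ i : Fin 3, (EuclideanSpace.proj i).comp
    (ContinuousLinearMap.apply ℝ E3 (EuclideanSpace.single i 1))

theorem traceL_fderiv (F : E3 → E3) (y : E3) : traceL (fderiv ℝ F y) = divergence F y := by
  simp [traceL, divergence]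

theorem inner_eq_sum (u v : E3) : inner ℝ u v = u 0 * v 0 + u 1 * v 1 + u 2 * v 2 := by
  simp [PiLp.inner_apply, Fin.sum_univ_three]
  ring

theorem cross_zero (u v : E3) : cross u v 0 = u 1 * v 2 - u 2 * v 1 := by
  simp [cross, cross_apply]

theorem cross_one (u v : E3) : cross u v 1 = u 2 * v 0 - u 0 * v 2 := by
  simp [cross, cross_apply]

theorem cross_two (u v : E3) : cross u v 2 = u 0 * v 1 - u 1 * v 0 := by
  simp [cross, cross_apply]

theorem inner_cross_self_left (u v : E3) : inner ℝ u (cross u v) = 0 := by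
  rw [inner_eq_sum, cross_zero, cross_one, cross_two]; ring

theorem inner_cross_self_right (u v : E3) : inner ℝ v (cross u v) = 0 := by
  rw [inner_eq_sum, cross_zero, cross_one, cross_two]; ring

/-- The map v ↦ v × b is a quarter turn of the component orthogonal to b; its square is minus the
projection onto that plane. -/
theorem cross_cross_right (v b : E3) (hb : inner ℝ b b = (1 : ℝ)) :
    cross (cross v b) b = (inner ℝ b v : ℝ) • b - v := by
  rw [inner_eq_sum] at hb
  ext i
  fin_cases i <;> simp [cross_zero, cross_one, cross_two, inner_eq_sum]
  · linear_combination (-v 0) * hb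
  · linear_combination (-v 1) * hb
  · linear_combination (-v 2) * hb

theorem cross_cross_left (v b : E3) (hb : inner ℝ b b = (1 : ℝ)) :
    cross b (cross v b) = v - (inner ℝ b v : ℝ) • b := by
  rw [inner_eq_sum] at hb
  ext i
  fin_cases i <;> simp [cross_zero, cross_one, cross_two, inner_eq_sum]
  · linear_combination (v 0) * hb
  · linear_combination (v 1) * hb
  · linear_combination (v 2) * hb

theorem clm_apply_eq (A : E3 →L[ℝ] E3) (v : E3) (i : Fin 3) :
    A v i = v 0 * A (EuclideanSpace.single 0 1) i + v 1 * A (EuclideanSpace.single 1 1) i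
      + v 2 * A (EuclideanSpace.single 2 1) i := by
  have : v = v 0 • EuclideanSpace.single (0 : Fin 3) (1 : ℝ) + v 1 • EuclideanSpace.single 1 1
      + v 2 • EuclideanSpace.single 2 1 := by
    ext j
    fin_cases j <;> simp
  conv_lhs => rw [this]
  simp only [map_add, map_smul]
  simp

/-- The trace of `A` on the plane orthogonal to the unit vector `b`, computed in the orthogonal
basis given by `v - ⟪b, v⟫ b` and `v × b`. -/
theorem trace_perp (A : E3 →L[ℝ] E3) (b v : E3) (hb : inner ℝ b b = (1 : ℝ))
    (hA : ∀ y, inner ℝ b (A y) = (0 : ℝ)) :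
    (inner ℝ v v - (inner ℝ b v : ℝ) ^ 2) * traceL A =
      inner ℝ (A (v - (inner ℝ b v : ℝ) • b)) (v - (inner ℝ b v : ℝ) • b)
        + inner ℝ (A (cross v b)) (cross v b) := by
  have h0 := hA (EuclideanSpace.single 0 1)
  have h1 := hA (EuclideanSpace.single 1 1)
  have h2 := hA (EuclideanSpace.single 2 1)
  have ht : traceL A = A (EuclideanSpace.single 0 1) 0 + A (EuclideanSpace.single 1 1) 1
      + A (EuclideanSpace.single 2 1) 2 := by
    simp [traceL, Fin.sum_univ_three]
  rw [ht]
  simp only [inner_eq_sum, clm_apply_eq A (v - _), clm_apply_eq A (cross v b), cross_zero,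
    cross_one, cross_two, PiLp.sub_apply, PiLp.smul_apply, smul_eq_mul] at h0 h1 h2 hb ⊢
  generalize A (EuclideanSpace.single 0 1) 0 = a00 at *
  generalize A (EuclideanSpace.single 0 1) 1 = a10 at *
  generalize A (EuclideanSpace.single 0 1) 2 = a20 at *
  generalize A (EuclideanSpace.single 1 1) 0 = a01 at *
  generalize A (EuclideanSpace.single 1 1) 1 = a11 at *
  generalize A (EuclideanSpace.single 1 1) 2 = a21 at *
  generalize A (EuclideanSpace.single 2 1) 0 = a02 at *
  generalize A (EuclideanSpace.single 2 1) 1 = a12 at *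
  generalize A (EuclideanSpace.single 2 1) 2 = a22 at *
  generalize b 0 = b0 at *
  generalize b 1 = b1 at *
  generalize b 2 = b2 at *
  generalize v 0 = v0 at *
  generalize v 1 = v1 at *
  generalize v 2 = v2 at *
  -- The sum `b0 * h0 + b1 * h1 + b2 * h2` is ⟨b, A b⟩ = 0, the normal entry by which the full trace
  -- differs from the planar one; the multiple of `hb` uses |b|² = 1.
  linear_combination ((v0 * v0 + v1 * v1 + v2 * v2) - (b0 * v0 + b1 * v1 + b2 * v2) ^ 2) *
    (b0 * h0 + b1 * h1 + b2 * h2) +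
    (v0 * v0 * a00 + v0 * v1 * a01 + v0 * v2 * a02 + v1 * v0 * a10 + v1 * v1 * a11
      + v1 * v2 * a12 + v2 * v0 * a20 + v2 * v1 * a21 + v2 * v2 * a22
      - (v0 * v0 + v1 * v1 + v2 * v2) * (a00 + a11 + a22)) * hb

end Field

/-! ### The coefficients of the corrected equations and their bounds. -/

section Coefficients

/-- The real inner product of `ℝ³` as a continuous bilinear map. -/
noncomputable def innerL : E3 →L[ℝ] E3 →L[ℝ] ℝ :=
  LinearMap.toContinuousBilinearMap (innerₗ E3)

theorem innerL_apply (u v : E3) : innerL u v = inner ℝ u v := rfl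

/-- The weight in terms of which all coefficients are polynomially bounded. -/
noncomputable def fieldWeight (B : E3 → E3) (y : E3) : ℝ := 1 + ‖B y‖⁻¹

/-- The field `B / |B|²`. -/
noncomputable def scaledField (B : E3 → E3) (y : E3) : E3 := ‖B y‖⁻¹ • unitField B y

/-- The quadratic form in the velocity whose derivative along the gyration is the oscillating
part of the parallel acceleration. -/
noncomputable def gyroForm (B : E3 → E3) (y : E3) : E3 →L[ℝ] E3 →L[ℝ] ℝ :=
  (-‖B y‖⁻¹) • (((ContinuousLinearMap.lsmul ℝ ℝ).flip
      ((innerL (fderiv ℝ (unitField B) y (unitField B y))).comp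
        (crossL.flip (unitField B y)))).comp (innerL (unitField B y)) +
    (1 / 2 : ℝ) • innerL.comp ((fderiv ℝ (unitField B) y).comp (crossL.flip (unitField B y))))

theorem gyroForm_apply (B : E3 → E3) (y v w : E3) : gyroForm B y v w = -‖B y‖⁻¹ *
    (inner ℝ (unitField B y) v *
      inner ℝ (fderiv ℝ (unitField B) y (unitField B y)) (cross w (unitField B y)) +
    1 / 2 * inner ℝ (fderiv ℝ (unitField B) y (cross v (unitField B y))) w) := by
  rfl

variable {B : E3 → E3}

theorem one_le_fieldWeight (y : E3) : 1 ≤ fieldWeight B y :=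
  le_add_of_nonneg_right (inv_nonneg.2 (norm_nonneg _))

variable (hB : BoundedCk 2 B) (hB0 : ∀ y, B y ≠ 0)

include hB in
theorem BoundedCk.tame : Tame (fieldWeight B) B := by
  obtain ⟨M0, h0⟩ := hB.2 0 (by norm_num)
  obtain ⟨M1, h1⟩ := hB.2 1 (by norm_num)
  refine ⟨hB.1.differentiable (by norm_num), .of_bound (M := M0) fun y => ?_,
    .of_bound (M := M1) fun y => ?_⟩
  · simpa using h0 y
  · simpa using h1 y

include hB in
theorem BoundedCk.tame_fderiv : Tame (fieldWeight B) (fderiv ℝ B) := by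
  obtain ⟨M1, h1⟩ := hB.2 1 (by norm_num)
  obtain ⟨M2, h2⟩ := hB.2 2 (by norm_num)
  have hc : ContDiff ℝ 1 (fderiv ℝ B) := hB.1.fderiv_right (by norm_num)
  refine ⟨hc.differentiable (by norm_num), .of_bound (M := M1) fun y => ?_,
    .of_bound (M := M2) fun y => ?_⟩
  · simpa using h1 y
  · rw [← norm_iteratedFDeriv_one, norm_iteratedFDeriv_fderiv]
    exact h2 y

/-- With ρ = 1/|f| the derivative is -ρ³ ⟨f, f' ·⟩, again polynomial in ρ, f and f'; this keeps the
coefficients within powers of the weight. The cube is nested as bilinear products to suit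
`PolyBounded.bilin` and `Tame.bilin`. -/
theorem hasFDerivAt_inv_norm {E : Type*} [NormedAddCommGroup E] [NormedSpace ℝ E] {f : E → E3}
    {f' : E →L[ℝ] E3} {y : E} (hf : HasFDerivAt f f' y) (h0 : f y ≠ 0) :
    HasFDerivAt (fun y => ‖f y‖⁻¹) ((-(‖f y‖⁻¹ * (‖f y‖⁻¹ * ‖f y‖⁻¹))) • (innerL (f y)).comp f') y := by
  have hn : ‖f y‖ ≠ 0 := norm_ne_zero_iff.2 h0
  have h1 := hf.norm_sq
  have h2 := h1.sqrt (pow_ne_zero 2 hn)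
  have h3 : HasFDerivAt (fun y => (√(‖f y‖ ^ 2))⁻¹) _ y :=
    (hasDerivAt_inv (by simpa using hn)).comp_hasFDerivAt y h2
  simp only [Real.sqrt_sq (norm_nonneg _)] at h3
  refine h3.congr_fderiv ?_
  ext w
  simp [innerL_apply]
  field_simp

include hB hB0

theorem fderiv_inv_norm : fderiv ℝ (fun y => ‖B y‖⁻¹) = fun y =>
    (-(‖B y‖⁻¹ * (‖B y‖⁻¹ * ‖B y‖⁻¹))) • (innerL (B y)).comp (fderiv ℝ B y) :=
  funext fun y => (hasFDerivAt_inv_norm (BoundedCk.tame hB |>.1 y).hasFDerivAt (hB0 y)).fderiv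

theorem tame_inv_norm : Tame (fieldWeight B) (fun y => ‖B y‖⁻¹) := by
  have hb : PolyBounded (fieldWeight B) (fun y => ‖B y‖⁻¹) :=
    ⟨1, 1, zero_le_one, fun y => by simp [fieldWeight]⟩
  have hB' := BoundedCk.tame hB
  refine ⟨fun y => (hasFDerivAt_inv_norm (hB'.1 y).hasFDerivAt (hB0 y)).differentiableAt, hb, ?_⟩
  rw [fderiv_inv_norm hB hB0]
  have h3 := PolyBounded.bilin (-(ContinuousLinearMap.mul ℝ ℝ)) hb
    (.bilin (ContinuousLinearMap.mul ℝ ℝ) hb hb)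
  have h4 := PolyBounded.bilin (ContinuousLinearMap.compL ℝ E3 E3 ℝ)
    (.bilin (ContinuousLinearMap.id ℝ _) (.of_bound (M := ‖innerL‖) (f := fun _ => innerL)
      fun _ => le_rfl) hB'.2) hB'.3
  exact PolyBounded.bilin (ContinuousLinearMap.lsmul ℝ ℝ) h3 h4

theorem tame_fderiv_inv_norm : Tame (fieldWeight B) (fderiv ℝ fun y => ‖B y‖⁻¹) := by
  have hW : ∀ y, 1 ≤ fieldWeight B y := one_le_fieldWeight
  have hρ := tame_inv_norm hB hB0
  rw [fderiv_inv_norm hB hB0]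
  have h3 := Tame.bilin hW (-(ContinuousLinearMap.mul ℝ ℝ)) hρ
    (.bilin hW (ContinuousLinearMap.mul ℝ ℝ) hρ hρ)
  exact Tame.smul hW (by simpa using h3)
    ((Tame.clm hW innerL (BoundedCk.tame hB)).clm_comp hW (BoundedCk.tame_fderiv hB))

theorem tame_unitField : Tame (fieldWeight B) (unitField B) :=
  (tame_inv_norm hB hB0).smul one_le_fieldWeight (BoundedCk.tame hB)

theorem tame_fderiv_unitField : Tame (fieldWeight B) (fderiv ℝ (unitField B)) :=
  Tame.fderiv_bilin one_le_fieldWeight (ContinuousLinearMap.lsmul ℝ ℝ) (tame_inv_norm hB hB0)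
    (BoundedCk.tame hB) (tame_fderiv_inv_norm hB hB0) (BoundedCk.tame_fderiv hB)

theorem tame_scaledField : Tame (fieldWeight B) (scaledField B) :=
  (tame_inv_norm hB hB0).smul one_le_fieldWeight (tame_unitField hB hB0)

theorem tame_divergence_unitField : Tame (fieldWeight B) (divergence (unitField B)) := by
  simp only [funext fun y => (traceL_fderiv (unitField B) y).symm]
  exact (tame_fderiv_unitField hB hB0).clm one_le_fieldWeight traceL

theorem tame_gyroForm : Tame (fieldWeight B) (gyroForm B) := by
  have hW : ∀ y, 1 ≤ fieldWeight B y := one_le_fieldWeight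
  have hρ := tame_inv_norm hB hB0
  have hb := tame_unitField hB hB0
  have hA := tame_fderiv_unitField hB hB0
  have hR := hb.clm hW crossL.flip
  have hρ' : Tame (fieldWeight B) (fun y => -‖B y‖⁻¹) := by
    simpa using hρ.clm hW (-ContinuousLinearMap.id ℝ ℝ)
  refine hρ'.smul hW (.add hW ?_ ?_)
  · exact ((((hA.clm_apply hW hb).clm hW innerL).clm_comp hW hR).clm hW
      (ContinuousLinearMap.lsmul ℝ ℝ).flip).clm_comp hW (hb.clm hW innerL)
  · exact (Tame.const _).smul hW ((Tame.const innerL).clm_comp hW (hA.clm_comp hW hR))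

end Coefficients

/-! ### The unit field and the averaging identity. -/

section UnitField

variable {B : E3 → E3} (hB0 : ∀ y, B y ≠ 0)

include hB0

theorem norm_unitField (y : E3) : ‖unitField B y‖ = 1 := by
  rw [unitField, norm_smul, norm_inv, norm_norm, inv_mul_cancel₀ (norm_ne_zero_iff.2 (hB0 y))]

theorem inner_unitField_self (y : E3) : inner ℝ (unitField B y) (unitField B y) = (1 : ℝ) := by
  rw [real_inner_self_eq_norm_sq, norm_unitField hB0, one_pow]

/-- Differentiate |b|² = 1. This is the hypothesis of `trace_perp` for A = Db. -/
theorem inner_unitField_fderiv (hd : Differentiable ℝ (unitField B)) (y w : E3) :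
    inner ℝ (unitField B y) (fderiv ℝ (unitField B) y w) = (0 : ℝ) := by
  have h1 := (hd y).hasFDerivAt.norm_sq
  have h2 : HasFDerivAt (fun y => ‖unitField B y‖ ^ 2) (0 : E3 →L[ℝ] ℝ) y := by
    simp only [norm_unitField hB0]
    exact hasFDerivAt_const _ _
  have h3 := DFunLike.congr_fun (h1.unique h2) w
  simpa using h3

theorem norm_smul_unitField (y : E3) : ‖B y‖ • unitField B y = B y := by
  rw [unitField, smul_smul, mul_inv_cancel₀ (norm_ne_zero_iff.2 (hB0 y)), one_smul]

theorem contDiff_unitField {n m : WithTop ℕ∞} (hB : ContDiff ℝ n B) (hm : m ≤ n) :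
    ContDiff ℝ m (unitField B) :=
  ((hB.norm ℝ hB0).inv (fun y => norm_ne_zero_iff.2 (hB0 y))).smul hB |>.of_le hm

theorem contDiff_divergence_unitField {n m : WithTop ℕ∞} (hB : ContDiff ℝ n B)
    (hm : m + 1 ≤ n) : ContDiff ℝ m (divergence (unitField B)) := by
  simp only [funext fun y => (traceL_fderiv (unitField B) y).symm]
  exact traceL.contDiff.comp ((contDiff_unitField hB0 hB le_rfl).fderiv_right hm)

/-- Along the gyration, the quadratic form `gyroForm` produces the oscillating part of the
parallel acceleration. -/
theorem gyroForm_gyration (hd : Differentiable ℝ (unitField B)) (y v : E3) :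
    gyroForm B y (cross v (B y)) v + gyroForm B y v (cross v (B y)) =
      inner ℝ (fderiv ℝ (unitField B) y v) v -
        1 / 2 * (‖v‖ ^ 2 - (inner ℝ (unitField B y) v : ℝ) ^ 2) * divergence (unitField B) y := by
  have hn : ‖B y‖ ≠ 0 := norm_ne_zero_iff.2 (hB0 y)
  have hA := inner_unitField_fderiv hB0 hd y
  have hbb := inner_unitField_self hB0 y
  have hcr : cross v (B y) = ‖B y‖ • cross v (unitField B y) := by
    conv_lhs => rw [← norm_smul_unitField hB0 y]
    rw [← crossL_apply, map_smul, crossL_apply]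
  have htr := trace_perp (fderiv ℝ (unitField B) y) (unitField B y) v hbb hA
  rw [traceL_fderiv] at htr
  rw [hcr, map_smul, map_smul, smul_apply, ← smul_add, gyroForm_apply,
    gyroForm_apply, cross_cross_right v _ hbb, inner_cross_self_right, ← real_inner_self_eq_norm_sq]
  generalize hb : unitField B y = b at *
  generalize fderiv ℝ (unitField B) y = A at *
  generalize divergence (unitField B) y = g at *
  generalize cross v b = w at *
  have hA' : ∀ z, inner ℝ (A z) b = (0 : ℝ) := fun z => by rw [real_inner_comm, hA]
  simp only [map_sub, map_smul, inner_sub_left, inner_sub_right, inner_smul_left, inner_smul_right,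
    hA', RCLike.conj_to_real, smul_eq_mul] at htr ⊢
  field_simp
  linear_combination htr

end UnitField

/-! ### Lorentz trajectories and their slow variables. -/

section Solutions

variable {B : E3 → E3} {ω : ℝ} {x₀ v₀ : E3} {ξ : ℝ → E3}

theorem LorentzLimit.IsLorentzSolution.hasDerivAt (h : IsLorentzSolution B ω x₀ v₀ ξ) (t : ℝ) :
    HasDerivAt ξ (deriv ξ t) t := (h.1 t).hasDerivAt

/-- The magnetic force is orthogonal to the velocity and does no work. -/
theorem LorentzLimit.IsLorentzSolution.norm_deriv (h : IsLorentzSolution B ω x₀ v₀ ξ) (t : ℝ) :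
    ‖deriv ξ t‖ = ‖v₀‖ := by
  have hd : ∀ s, HasDerivAt (fun s => ‖deriv ξ s‖ ^ 2) 0 s := by
    intro s
    have := (h.2.1 s).norm_sq
    rwa [inner_smul_right, inner_cross_self_left, mul_zero, mul_zero] at this
  have := is_const_of_deriv_eq_zero (fun s => (hd s).differentiableAt) (fun s => (hd s).deriv) t 0
  rw [h.2.2.2] at this
  exact (sq_eq_sq₀ (norm_nonneg _) (norm_nonneg _)).1 this

theorem LorentzLimit.IsLorentzSolution.norm_sub_le (h : IsLorentzSolution B ω x₀ v₀ ξ) (t s : ℝ) :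
    ‖ξ t - ξ s‖ ≤ ‖v₀‖ * |t - s| :=
  convex_univ.norm_image_sub_le_of_norm_hasDerivWithin_le
    (fun r _ => (h.hasDerivAt r).hasDerivWithinAt) (fun r _ => (h.norm_deriv r).le)
    (mem_univ s) (mem_univ t)

/-- The phase space vector field of the Lorentz equation. -/
noncomputable def lorentzField (B : E3 → E3) (ω : ℝ) (z : E3 × E3) : E3 × E3 :=
  (z.2, ω • crossL z.2 (B z.1))

theorem contDiff_lorentzField (hB : ContDiff ℝ 1 B) (ω : ℝ) : ContDiff ℝ 1 (lorentzField B ω) := by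
  refine contDiff_snd.prodMk (ContDiff.const_smul ω ?_)
  exact (crossL.contDiff.comp contDiff_snd).clm_apply (hB.comp contDiff_fst)

theorem existsUnique_lorentzSolution (hB : ContDiff ℝ 1 B) (ω : ℝ) (x₀ v₀ : E3) :
    ∃! ξ : ℝ → E3, IsLorentzSolution B ω x₀ v₀ ξ := by
  have hF := contDiff_lorentzField hB ω
  obtain ⟨z, hz0, hz, -, -⟩ := exists_global_solution_of_conserved hF (fun _ => le_rfl)
    (fun z => by
      rw [lorentzField, inner_smul_right, crossL_apply, inner_cross_self_left, mul_zero]) (x₀, v₀)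
  have h1 : ∀ t, HasDerivAt (fun s => (z s).1) (z t).2 t := fun t =>
    (ContinuousLinearMap.fst ℝ E3 E3).hasFDerivAt.comp_hasDerivAt t (hz t)
  have h2 : ∀ t, HasDerivAt (fun s => (z s).2) (ω • cross (z t).2 (B (z t).1)) t := fun t =>
    (ContinuousLinearMap.snd ℝ E3 E3).hasFDerivAt.comp_hasDerivAt t (hz t)
  have hd : deriv (fun s => (z s).1) = fun s => (z s).2 := funext fun t => (h1 t).deriv
  refine ⟨fun s => (z s).1, ⟨fun t => (h1 t).differentiableAt, ?_, by simp [hz0], by simp [hd, hz0]⟩,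
    fun ξ hξ => ?_⟩
  · rw [hd]
    exact h2
  · have := ODE_global_solution_unique hF (y := fun t => (ξ t, deriv ξ t)) (z := z)
      (fun t => (hξ.hasDerivAt t).prodMk (hξ.2.1 t)) hz (by simp [hz0, hξ.2.2.1, hξ.2.2.2])
    funext t
    exact congrArg Prod.fst (congrFun this t)

variable (hB : BoundedCk 2 B) (hB0 : ∀ y, B y ≠ 0)

include hB hB0 in
/-- The guiding centre moves along the field up to an error of order `1/ω`. -/
theorem hasDerivAt_guidingCenter (hω : ω ≠ 0) (h : IsLorentzSolution B ω x₀ v₀ ξ) (t : ℝ) :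
    HasDerivAt (fun s => ξ s - ω⁻¹ • crossL (scaledField B (ξ s)) (deriv ξ s))
      ((inner ℝ (unitField B (ξ t)) (deriv ξ t) : ℝ) • unitField B (ξ t) -
        ω⁻¹ • crossL (fderiv ℝ (scaledField B) (ξ t) (deriv ξ t)) (deriv ξ t)) t := by
  have hn : ‖B (ξ t)‖ ≠ 0 := norm_ne_zero_iff.2 (hB0 _)
  have hc : HasDerivAt (fun s => scaledField B (ξ s))
      (fderiv ℝ (scaledField B) (ξ t) (deriv ξ t)) t :=
    ((tame_scaledField hB hB0).1 _).hasFDerivAt.comp_hasDerivAt t (h.hasDerivAt t)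
  have h1 := (crossL.hasFDerivAt.comp_hasDerivAt t hc).clm_apply (h.2.1 t)
  refine ((h.hasDerivAt t).sub (h1.const_smul ω⁻¹)).congr_deriv ?_
  -- The force carries a factor ω, which cancels the ω⁻¹ of the correction; what remains removes
  -- exactly the perpendicular part of the velocity.
  have key : crossL (scaledField B (ξ t)) (ω • cross (deriv ξ t) (B (ξ t))) =
      ω • (deriv ξ t - (inner ℝ (unitField B (ξ t)) (deriv ξ t) : ℝ) • unitField B (ξ t)) := by
    conv_lhs =>
      enter [2, 2]
      rw [← norm_smul_unitField hB0, ← crossL_apply, map_smul]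
    rw [scaledField, map_smul, map_smul, map_smul, smul_apply, smul_comm ‖B (ξ t)‖, smul_smul,
      smul_smul, mul_assoc, inv_mul_cancel₀ hn, mul_one, crossL_apply, crossL_apply,
      cross_cross_left _ _ (inner_unitField_self hB0 _)]
  rw [Function.comp_apply, smul_add, key, smul_smul, inv_mul_cancel₀ hω, one_smul]
  abel

include hB hB0 in
/-- The corrected parallel velocity satisfies the averaged equation up to an error of
order `1/ω`. -/
theorem hasDerivAt_parallelVelocity (hω : ω ≠ 0) (h : IsLorentzSolution B ω x₀ v₀ ξ) (t : ℝ) :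
    HasDerivAt (fun s => (inner ℝ (unitField B (ξ s)) (deriv ξ s) : ℝ) -
        ω⁻¹ * gyroForm B (ξ s) (deriv ξ s) (deriv ξ s))
      (1 / 2 * (‖v₀‖ ^ 2 - (inner ℝ (unitField B (ξ t)) (deriv ξ t) : ℝ) ^ 2) *
        divergence (unitField B) (ξ t) -
        ω⁻¹ * fderiv ℝ (gyroForm B) (ξ t) (deriv ξ t) (deriv ξ t) (deriv ξ t)) t := by
  have hd := (tame_unitField hB hB0).1
  have hb : HasDerivAt (fun s => unitField B (ξ s))
      (fderiv ℝ (unitField B) (ξ t) (deriv ξ t)) t :=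
    (hd _).hasFDerivAt.comp_hasDerivAt t (h.hasDerivAt t)
  have hs : HasDerivAt (fun s => gyroForm B (ξ s))
      (fderiv ℝ (gyroForm B) (ξ t) (deriv ξ t)) t :=
    ((tame_gyroForm hB hB0).1 _).hasFDerivAt.comp_hasDerivAt t (h.hasDerivAt t)
  have h1 := hb.inner ℝ (h.2.1 t)
  have h2 := (hs.clm_apply (h.2.1 t)).clm_apply (h.2.1 t)
  refine (h1.sub (h2.const_mul ω⁻¹)).congr_deriv ?_
  have hort : inner ℝ (unitField B (ξ t)) (cross (deriv ξ t) (B (ξ t))) = (0 : ℝ) := by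
    rw [unitField, inner_smul_left, inner_cross_self_right, mul_zero]
  have hg := gyroForm_gyration hB0 hd (ξ t) (deriv ξ t)
  rw [h.norm_deriv] at hg
  simp only [inner_smul_right, hort, map_smul, add_apply, smul_apply, smul_eq_mul]
  field_simp
  field_simp at hg
  linear_combination (-ω) * hg

end Solutions

/-! ### The averaged system. -/

section Limit

variable {B : E3 → E3}

/-- The averaged vector field on `ℝ³ × ℝ²`; the second component holds the parallel speed and the
perpendicular speed. -/
noncomputable def averagedField (B : E3 → E3) (z : E3 × EuclideanSpace ℝ (Fin 2)) :
    E3 × EuclideanSpace ℝ (Fin 2) :=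
  (z.2 0 • unitField B z.1,
    (1 / 2 * (z.2 1 * divergence (unitField B) z.1)) • !₂[z.2 1, -z.2 0])

/-- One derivative is lost to the divergence of b. -/
theorem contDiff_averagedField (hB0 : ∀ y, B y ≠ 0) {n m : WithTop ℕ∞} (hB : ContDiff ℝ n B)
    (hm : m + 1 ≤ n) : ContDiff ℝ m (averagedField B) := by
  have hc : ∀ i : Fin 2, ContDiff ℝ m
      (fun z : E3 × EuclideanSpace ℝ (Fin 2) => z.2 i) := fun i =>
    (EuclideanSpace.proj i : EuclideanSpace ℝ (Fin 2) →L[ℝ] ℝ).contDiff.comp contDiff_snd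
  have hb : ContDiff ℝ m (unitField B) := contDiff_unitField hB0 hB (le_self_add.trans hm)
  have hg : ContDiff ℝ m (divergence (unitField B)) := contDiff_divergence_unitField hB0 hB hm
  refine ((hc 0).smul (hb.comp contDiff_fst)).prodMk
    ((contDiff_const.mul ((hc 1).mul (hg.comp contDiff_fst))).smul ?_)
  rw [contDiff_euclidean]
  intro i
  fin_cases i
  · simpa using hc 1
  · simpa using (hc 0).neg

/-- The limit trajectory together with its parallel speed. -/
theorem exists_averaged_solution (hB0 : ∀ y, B y ≠ 0) (hB : ContDiff ℝ 2 B) (x₀ v₀ : E3) :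
    ∃ (x : ℝ → E3) (h : ℝ → ℝ), x 0 = x₀ ∧ h 0 = inner ℝ (unitField B x₀) v₀ ∧
      (∀ t, HasDerivAt x (h t • unitField B (x t)) t) ∧
      (∀ t, HasDerivAt h (1 / 2 * (‖v₀‖ ^ 2 - h t ^ 2) * divergence (unitField B) (x t)) t) ∧
      (∀ t, |h t| ≤ ‖v₀‖) ∧ (∀ t, ‖x t - x₀‖ ≤ ‖v₀‖ * |t|) ∧
      (∀ k : ℕ, ContDiff ℝ (k + 1) B → ContDiff ℝ (k + 1) x ∧ ContDiff ℝ (k + 1) h) ∧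
      (AnalyticOnNhd ℝ B univ → AnalyticOnNhd ℝ x univ) := by
  set V := ‖v₀‖
  set h₀ : ℝ := inner ℝ (unitField B x₀) v₀
  have hh₀ : h₀ ^ 2 ≤ V ^ 2 := by
    rw [sq_le_sq, abs_of_nonneg (norm_nonneg v₀)]
    simpa [norm_unitField hB0] using abs_real_inner_le_norm (unitField B x₀) v₀
  have hn : ∀ w : EuclideanSpace ℝ (Fin 2), ‖w‖ ^ 2 = w 0 ^ 2 + w 1 ^ 2 := fun w => by
    simp [EuclideanSpace.norm_sq_eq]
  have hle : ∀ w : EuclideanSpace ℝ (Fin 2), |w 0| ≤ ‖w‖ := fun w => by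
    simpa using PiLp.norm_apply_le w 0
  -- Adding the perpendicular speed w, with w' = -½ h w div b, makes h² + w² conserved. The
  -- completeness theorem then applies and yields |h| ≤ |v₀|.
  obtain ⟨z, hz0, hz, hc, hx⟩ := exists_global_solution_of_conserved
    (contDiff_averagedField hB0 hB (m := 1) (by norm_num))
    (fun z => by
      rw [averagedField, norm_smul, norm_unitField hB0, mul_one]
      exact hle z.2)
    (fun z => by
      rw [averagedField, inner_smul_right]
      simp [PiLp.inner_apply]
      right
      ring) (x₀, !₂[h₀, √(V ^ 2 - h₀ ^ 2)])
  have hV : ‖!₂[h₀, √(V ^ 2 - h₀ ^ 2)]‖ = V := by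
    refine (sq_eq_sq₀ (norm_nonneg _) (norm_nonneg _)).1 ?_
    rw [hn]
    simp [Real.sq_sqrt (sub_nonneg.2 hh₀), V]
  simp only [hV] at hc hx
  have hz2 : ∀ t, (z t).2 1 ^ 2 = V ^ 2 - (z t).2 0 ^ 2 := fun t => by
    rw [← hc t, hn]; ring
  let P : E3 × EuclideanSpace ℝ (Fin 2) →L[ℝ] ℝ :=
    (EuclideanSpace.proj (0 : Fin 2)).comp (ContinuousLinearMap.snd ℝ _ _)
  refine ⟨fun t => (z t).1, fun t => (z t).2 0, by simp [hz0], by simp [hz0], fun t => ?_,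
    fun t => ?_, fun t => ?_, hx, fun k hk => ?_, fun ha => ?_⟩
  · exact (ContinuousLinearMap.fst ℝ E3 _).hasFDerivAt.comp_hasDerivAt t (hz t)
  · refine (P.hasFDerivAt.comp_hasDerivAt t (hz t)).congr_deriv ?_
    rw [← hz2]
    simp [P, averagedField]
    ring
  · rw [← hc t]
    exact hle _
  · have := contDiff_succ_of_hasDerivAt (n := k) (contDiff_averagedField hB0 hk le_rfl) hz
    exact ⟨contDiff_fst.comp this, P.contDiff.comp this⟩
  · have hω : ContDiff ℝ ⊤ B := contDiff_omega_iff_analyticOnNhd.2 ha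
    have hF := contDiff_omega_iff_analyticOnNhd.1
      (contDiff_averagedField hB0 hω (m := ⊤) (by simp))
    intro t ht
    exact (ContinuousLinearMap.fst ℝ E3 (EuclideanSpace ℝ (Fin 2))).analyticAt _ |>.comp
      (analyticOnNhd_of_hasDerivAt hF hz t ht)

end Limit

/-! ### Grönwall estimate with rate 1/ω. -/

section Estimate

theorem gronwallBound_le {δ K ε t : ℝ} (hK : 1 ≤ K) (hε : 0 ≤ ε) :
    gronwallBound δ K ε t ≤ (δ + ε) * Real.exp (K * t) := by
  rw [gronwallBound_of_K_ne_0 (by linarith)]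
  have h1 : ε / K ≤ ε := div_le_self hε hK
  have h0 : 0 ≤ ε / K := by positivity
  nlinarith [mul_le_mul_of_nonneg_right h1 (Real.exp_pos (K * t)).le]

theorem const_mul_pow_le {C C' w β : ℝ} {p p' : ℕ} (hC : 0 ≤ C) (hCC : C ≤ C') (hp : p ≤ p')
    (hw : 0 ≤ w) (hwβ : w ≤ β) (hβ : 1 ≤ β) : C * w ^ p ≤ C' * β ^ p' := by
  have : w ^ p ≤ β ^ p' := (pow_le_pow_left₀ hw hwβ p).trans (pow_le_pow_right₀ hβ hp)
  exact mul_le_mul hCC this (by positivity) (hC.trans hCC)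

/-- Here E is the size of the corrected differences, D bounds the coefficients, κ is the norm of the
cross product and η = 1/ω. The summands bound the error in the parallel velocity, the variation of
b, and the remainder. With D = 1 + d the difference of the two sides has nonnegative coefficients.
-/
theorem guidingCenter_rate_le {E D V κ η : ℝ} (hE : 0 ≤ E) (hD : 1 ≤ D) (hV : 0 ≤ V) (hκ : 0 ≤ κ)
    (hη : 0 ≤ η) :
    (E + η * (D * V * V)) + V * (D * (E + η * (κ * D * V))) + η * (κ * (D * V) * V) ≤
      2 * (1 + κ) * (1 + V) ^ 3 * D * E + 2 * (1 + κ) * (1 + V) ^ 3 * D ^ 2 * η := by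
  obtain ⟨d, hd, rfl⟩ : ∃ d, 0 ≤ d ∧ D = 1 + d := ⟨D - 1, by linarith, by ring⟩
  rw [← sub_nonneg]
  ring_nf
  positivity

theorem parallelVelocity_rate_le {E D V κ η : ℝ} (hE : 0 ≤ E) (hD : 1 ≤ D) (hV : 0 ≤ V)
    (hκ : 0 ≤ κ) (hη : 0 ≤ η) :
    V * (E + η * (D * V * V)) * D + 1 / 2 * V ^ 2 * (D * (E + η * (κ * D * V))) +
      η * (D * V * V * V) ≤
      2 * (1 + κ) * (1 + V) ^ 3 * D * E + 2 * (1 + κ) * (1 + V) ^ 3 * D ^ 2 * η := by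
  obtain ⟨d, hd, rfl⟩ : ∃ d, 0 ≤ d ∧ D = 1 + d := ⟨D - 1, by linarith, by ring⟩
  rw [← sub_nonneg]
  ring_nf
  positivity

theorem displacement_le {D V κ η : ℝ} (hD : 1 ≤ D) (hV : 0 ≤ V) (hκ : 0 ≤ κ) (hη : 0 ≤ η) :
    η * (κ * D * V) ≤ 2 * (1 + κ) * (1 + V) ^ 3 * D ^ 2 * η ∧
    η * (D * V * V) ≤ 2 * (1 + κ) * (1 + V) ^ 3 * D ^ 2 * η := by
  obtain ⟨d, hd, rfl⟩ : ∃ d, 0 ≤ d ∧ D = 1 + d := ⟨D - 1, by linarith, by ring⟩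
  constructor <;>
  · rw [← sub_nonneg]
    ring_nf
    positivity

variable {B : E3 → E3} (hB : BoundedCk 2 B) (hB0 : ∀ y, B y ≠ 0)

include hB hB0

set_option maxSynthPendingDepth 3 in
/-- All coefficients are bounded by a common multiple of a power of the weight. -/
theorem exists_coefficient_bound : ∃ (C : ℝ) (p : ℕ), 1 ≤ C ∧ ∀ β, 1 ≤ β → ∀ y,
    fieldWeight B y ≤ β →
      ‖scaledField B y‖ ≤ C * β ^ p ∧ ‖fderiv ℝ (scaledField B) y‖ ≤ C * β ^ p ∧
      ‖fderiv ℝ (unitField B) y‖ ≤ C * β ^ p ∧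
      ‖divergence (unitField B) y‖ ≤ C * β ^ p ∧
      ‖fderiv ℝ (divergence (unitField B)) y‖ ≤ C * β ^ p ∧
      ‖gyroForm B y‖ ≤ C * β ^ p ∧ ‖fderiv ℝ (gyroForm B) y‖ ≤ C * β ^ p := by
  obtain ⟨C1, p1, hC1, h1⟩ := (tame_scaledField hB hB0).2
  obtain ⟨C2, p2, hC2, h2⟩ := (tame_scaledField hB hB0).3
  obtain ⟨C3, p3, hC3, h3⟩ := (tame_unitField hB hB0).3
  obtain ⟨C4, p4, hC4, h4⟩ := (tame_divergence_unitField hB hB0).2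
  obtain ⟨C5, p5, hC5, h5⟩ := (tame_divergence_unitField hB hB0).3
  obtain ⟨C6, p6, hC6, h6⟩ := (tame_gyroForm hB hB0).2
  obtain ⟨C7, p7, hC7, h7⟩ := (tame_gyroForm hB hB0).3
  refine ⟨1 + (C1 + C2 + C3 + C4 + C5 + C6 + C7), p1 + p2 + p3 + p4 + p5 + p6 + p7, by linarith,
    fun β hβ y hy => ?_⟩
  have hw : 0 ≤ fieldWeight B y := zero_le_one.trans (one_le_fieldWeight y)
  exact ⟨(h1 y).trans (const_mul_pow_le hC1 (by linarith) (by omega) hw hy hβ),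
    (h2 y).trans (const_mul_pow_le hC2 (by linarith) (by omega) hw hy hβ),
    (h3 y).trans (const_mul_pow_le hC3 (by linarith) (by omega) hw hy hβ),
    (h4 y).trans (const_mul_pow_le hC4 (by linarith) (by omega) hw hy hβ),
    (h5 y).trans (const_mul_pow_le hC5 (by linarith) (by omega) hw hy hβ),
    (h6 y).trans (const_mul_pow_le hC6 (by linarith) (by omega) hw hy hβ),
    (h7 y).trans (const_mul_pow_le hC7 (by linarith) (by omega) hw hy hβ)⟩

set_option maxSynthPendingDepth 3 in
/-- Convergence with rate `1/ω`, with constants polynomial in a bound `β` for the weight on the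
region reached up to time `T`. -/
theorem exists_rate_estimate (x₀ v₀ : E3) : ∃ (C : ℝ) (p : ℕ), 1 ≤ C ∧
    ∀ (T β : ℝ), 0 ≤ T → 1 ≤ β → (∀ y, ‖y - x₀‖ ≤ ‖v₀‖ * T → fieldWeight B y ≤ β) →
    ∀ (x : ℝ → E3) (h : ℝ → ℝ), x 0 = x₀ → h 0 = inner ℝ (unitField B x₀) v₀ →
      (∀ t, HasDerivAt x (h t • unitField B (x t)) t) →
      (∀ t, HasDerivAt h (1 / 2 * (‖v₀‖ ^ 2 - h t ^ 2) * divergence (unitField B) (x t)) t) →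
      (∀ t, |h t| ≤ ‖v₀‖) → (∀ t, ‖x t - x₀‖ ≤ ‖v₀‖ * |t|) →
    ∀ (ω : ℝ) (ξ : ℝ → E3), 0 < ω → IsLorentzSolution B ω x₀ v₀ ξ → ∀ t ∈ Icc 0 T,
      ‖ξ t - x t‖ ≤ C * β ^ p * Real.exp (C * β ^ p * T) / ω := by
  obtain ⟨C₀, p, hC₀, hco⟩ := exists_coefficient_bound hB hB0
  set V := ‖v₀‖
  set κ := ‖crossL‖
  have hV : 0 ≤ V := norm_nonneg _
  have hκ : 0 ≤ κ := norm_nonneg crossL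
  set C₁ : ℝ := 2 * (1 + κ) * (1 + V) ^ 3
  have hC₁ : 1 ≤ C₁ := by
    have h1 : 1 ≤ (1 + V) ^ 3 := one_le_pow₀ (by linarith)
    have h2 : 1 ≤ 2 * (1 + κ) := by linarith
    exact one_le_mul_of_one_le_of_one_le h2 h1
  refine ⟨3 * C₁ * C₀ ^ 2, 2 * p, ?_, ?_⟩
  · have : 1 ≤ C₀ ^ 2 := one_le_pow₀ hC₀
    nlinarith
  intro T β hT hβ hball x h hx0 hh0 hx hh hhV hxV ω ξ hω hξ
  set D := C₀ * β ^ p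
  have hβp : 1 ≤ β ^ p := one_le_pow₀ hβ
  have hD : 1 ≤ D := one_le_mul_of_one_le_of_one_le hC₀ hβp
  have hD0 : 0 ≤ D := zero_le_one.trans hD
  set η := ω⁻¹
  have hη : 0 ≤ η := inv_nonneg.2 hω.le
  let S := Metric.closedBall x₀ (V * T)
  have hcoS : ∀ y ∈ S, _ := fun y hy => hco β hβ y (hball y (mem_closedBall_iff_norm.1 hy))
  have hxS : ∀ t ∈ Icc 0 T, x t ∈ S := fun t ht => by
    rw [mem_closedBall_iff_norm]
    refine (hxV t).trans ?_
    rw [abs_of_nonneg ht.1]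
    exact mul_le_mul_of_nonneg_left ht.2 hV
  have hξS : ∀ t ∈ Icc 0 T, ξ t ∈ S := fun t ht => by
    rw [mem_closedBall_iff_norm]
    have := hξ.norm_sub_le t 0
    rw [hξ.2.2.1, sub_zero, abs_of_nonneg ht.1] at this
    exact this.trans (mul_le_mul_of_nonneg_left ht.2 hV)
  have hv : ∀ t, ‖deriv ξ t‖ = V := hξ.norm_deriv
  have hlipb : ∀ y ∈ S, ∀ z ∈ S, ‖unitField B y - unitField B z‖ ≤ D * ‖y - z‖ :=
    fun y hy z hz => (convex_closedBall _ _).norm_image_sub_le_of_norm_fderiv_le (𝕜 := ℝ)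
      (fun w _ => (tame_unitField hB hB0).1 w) (fun w hw => (hcoS w hw).2.2.1) hz hy
  have hlipg : ∀ y ∈ S, ∀ z ∈ S,
      ‖divergence (unitField B) y - divergence (unitField B) z‖ ≤ D * ‖y - z‖ :=
    fun y hy z hz => (convex_closedBall _ _).norm_image_sub_le_of_norm_fderiv_le (𝕜 := ℝ)
      (fun w _ => (tame_divergence_unitField hB hB0).1 w) (fun w hw => (hcoS w hw).2.2.2.2.1) hz hy
  let u : ℝ → ℝ := fun t => inner ℝ (unitField B (ξ t)) (deriv ξ t)
  have huV : ∀ t, |u t| ≤ V := fun t => by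
    have := abs_real_inner_le_norm (unitField B (ξ t)) (deriv ξ t)
    rwa [norm_unitField hB0, one_mul, hv] at this
  -- Corrected differences: their derivatives are free of ω-large terms, and they differ from the
  -- true ones by O(1/ω).
  let d₁ : ℝ → E3 := fun t => ξ t - η • crossL (scaledField B (ξ t)) (deriv ξ t) - x t
  let d₂ : ℝ → ℝ := fun t => u t - η * gyroForm B (ξ t) (deriv ξ t) (deriv ξ t) - h t
  have hd₁ := fun t => (hasDerivAt_guidingCenter hB hB0 hω.ne' hξ t).sub (hx t)
  have hd₂ := fun t => (hasDerivAt_parallelVelocity hB hB0 hω.ne' hξ t).sub (hh t)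
  have hd := fun t => (hd₁ t).prodMk (hd₂ t)
  have hc1 : ∀ t ∈ Icc 0 T, ‖η • crossL (scaledField B (ξ t)) (deriv ξ t)‖ ≤ η * (κ * D * V) := by
    intro t ht
    rw [norm_smul, Real.norm_of_nonneg hη, ← hv t]
    refine mul_le_mul_of_nonneg_left ((crossL.le_opNorm₂ _ _).trans ?_) hη
    gcongr
    exact (hcoS _ (hξS t ht)).1
  have hc2 : ∀ t ∈ Icc 0 T, |η * gyroForm B (ξ t) (deriv ξ t) (deriv ξ t)| ≤ η * (D * V * V) := by
    intro t ht
    rw [abs_mul, abs_of_nonneg hη, ← hv t, ← Real.norm_eq_abs]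
    refine mul_le_mul_of_nonneg_left (((gyroForm B (ξ t)).le_opNorm₂ _ _).trans ?_) hη
    gcongr
    exact (hcoS _ (hξS t ht)).2.2.2.2.2.1
  have hξx : ∀ t ∈ Icc 0 T, ‖ξ t - x t‖ ≤ ‖d₁ t‖ + η * (κ * D * V) := by
    intro t ht
    have : ξ t - x t = d₁ t + η • crossL (scaledField B (ξ t)) (deriv ξ t) := by
      simp only [d₁]; abel
    rw [this]
    exact (norm_add_le _ _).trans (by gcongr; exact hc1 t ht)
  have huh : ∀ t ∈ Icc 0 T, |u t - h t| ≤ |d₂ t| + η * (D * V * V) := by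
    intro t ht
    have : u t - h t = d₂ t + η * gyroForm B (ξ t) (deriv ξ t) (deriv ξ t) := by
      simp only [d₂]; ring
    rw [this]
    exact (abs_add_le _ _).trans (by gcongr; exact hc2 t ht)
  -- δ bounds the corrections at time 0, where the uncorrected differences vanish; ε collects the
  -- forcing of order 1/ω.
  have hgr := norm_le_gronwallBound_of_norm_deriv_right_le (f := fun t => (d₁ t, d₂ t)) (a := 0)
    (b := T) (δ := C₁ * D ^ 2 * η) (K := C₁ * D) (ε := C₁ * D ^ 2 * η)
    (fun t _ => (hd t).continuousAt.continuousWithinAt)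
    (fun t _ => (hd t).hasDerivWithinAt) ?_ ?_
  · intro t ht
    have h1 : ‖d₁ t‖ ≤ 2 * (C₁ * D ^ 2 * η) * Real.exp (C₁ * D * t) := by
      refine (norm_fst_le ((d₁ t, d₂ t) : E3 × ℝ)).trans ((hgr t ht).trans ?_)
      rw [sub_zero]
      refine (gronwallBound_le (one_le_mul_of_one_le_of_one_le hC₁ hD) (by positivity)).trans ?_
      rw [two_mul]
    have h2 := (displacement_le hD hV hκ hη).1
    have h3 : Real.exp (C₁ * D * t) ≤ Real.exp (C₁ * D * T) := by
      have := ht.2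
      gcongr
    have h4 : 1 ≤ Real.exp (C₁ * D * T) := Real.one_le_exp (by positivity)
    have h5 : ‖ξ t - x t‖ ≤ 3 * (C₁ * D ^ 2 * η) * Real.exp (C₁ * D * T) := by
      refine (hξx t ht).trans ?_
      have h6 : 0 ≤ C₁ * D ^ 2 * η := by positivity
      have h7 := mul_le_mul_of_nonneg_left h3 h6
      have h8 := mul_le_mul_of_nonneg_left h4 h6
      change η * (κ * D * V) ≤ C₁ * D ^ 2 * η at h2
      linarith
    refine h5.trans ?_
    -- Since D ≤ D², one constant and one power of β serve both the prefactor and the exponent.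
    have h9 : C₁ * D ≤ 3 * C₁ * C₀ ^ 2 * β ^ (2 * p) := by
      have : D ≤ D ^ 2 := by nlinarith
      have h10 : D ^ 2 = C₀ ^ 2 * β ^ (2 * p) := by simp only [D]; ring
      have h11 : 0 ≤ C₁ := by linarith
      calc C₁ * D ≤ C₁ * D ^ 2 := by gcongr
        _ ≤ 3 * (C₁ * D ^ 2) := by
          have : 0 ≤ C₁ * D ^ 2 := by positivity
          linarith
        _ = _ := by rw [h10]; ring
    calc 3 * (C₁ * D ^ 2 * η) * Real.exp (C₁ * D * T)
        ≤ 3 * (C₁ * D ^ 2 * η) * Real.exp (3 * C₁ * C₀ ^ 2 * β ^ (2 * p) * T) := by gcongr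
      _ = _ := by simp only [D, η]; ring
  · have h0 : (0 : ℝ) ∈ Icc 0 T := ⟨le_rfl, hT⟩
    have hd10 : d₁ 0 = -(η • crossL (scaledField B (ξ 0)) (deriv ξ 0)) := by
      simp only [d₁, hξ.2.2.1, hx0]; abel
    have hd20 : d₂ 0 = -(η * gyroForm B (ξ 0) (deriv ξ 0) (deriv ξ 0)) := by
      simp only [d₂, u, hξ.2.2.1, hξ.2.2.2, hh0]; ring
    rw [Prod.norm_def, max_le_iff]
    constructor
    · simp only [hd10, norm_neg]
      exact (hc1 0 h0).trans (displacement_le hD hV hκ hη).1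
    · simp only [hd20, norm_neg, Real.norm_eq_abs]
      exact (hc2 0 h0).trans (displacement_le hD hV hκ hη).2
  · intro t ht'
    have ht : t ∈ Icc 0 T := Ico_subset_Icc_self ht'
    set E := ‖(d₁ t, d₂ t)‖
    have hE : 0 ≤ E := norm_nonneg _
    have hE1 : ‖d₁ t‖ ≤ E := norm_fst_le ((d₁ t, d₂ t) : E3 × ℝ)
    have hE2 : |d₂ t| ≤ E := norm_snd_le ((d₁ t, d₂ t) : E3 × ℝ)
    have hX : ‖ξ t - x t‖ ≤ E + η * (κ * D * V) := (hξx t ht).trans (by gcongr)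
    have hU : |u t - h t| ≤ E + η * (D * V * V) := (huh t ht).trans (by gcongr)
    have hbd := hlipb _ (hξS t ht) _ (hxS t ht)
    have hgd := hlipg _ (hξS t ht) _ (hxS t ht)
    obtain ⟨-, hDc, -, hg, -, -, hDs⟩ := hcoS _ (hξS t ht)
    rw [Prod.norm_def, max_le_iff]
    constructor
    · refine le_trans ?_ (guidingCenter_rate_le hE hD hV hκ hη)
      have hsplit : (u t • unitField B (ξ t) -
          η • crossL (fderiv ℝ (scaledField B) (ξ t) (deriv ξ t)) (deriv ξ t)) -
          h t • unitField B (x t) =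
          (u t - h t) • unitField B (ξ t) + h t • (unitField B (ξ t) - unitField B (x t)) -
          η • crossL (fderiv ℝ (scaledField B) (ξ t) (deriv ξ t)) (deriv ξ t) := by
        rw [sub_smul, smul_sub]; abel
      change ‖(u t • unitField B (ξ t) -
          η • crossL (fderiv ℝ (scaledField B) (ξ t) (deriv ξ t)) (deriv ξ t)) -
          h t • unitField B (x t)‖ ≤ _
      rw [hsplit]
      refine (norm_sub_le _ _).trans (add_le_add ((norm_add_le _ _).trans (add_le_add ?_ ?_)) ?_)
      · rwa [norm_smul, norm_unitField hB0, mul_one]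
      · rw [norm_smul]
        have := hhV t
        have := hbd.trans (mul_le_mul_of_nonneg_left hX hD0)
        exact mul_le_mul (hhV t) this (norm_nonneg _) hV
      · rw [norm_smul, Real.norm_of_nonneg hη]
        refine mul_le_mul_of_nonneg_left ((crossL.le_opNorm₂ _ _).trans ?_) hη
        rw [hv]
        gcongr
        exact (ContinuousLinearMap.le_opNorm _ _).trans (by rw [hv]; gcongr)
    · refine le_trans ?_ (parallelVelocity_rate_le hE hD hV hκ hη)
      -- The difference of squares u² - h² is factored, so that |½ (u + h)| ≤ V leaves an estimate
      -- linear in u - h.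
      have hsplit : (1 / 2 * (V ^ 2 - u t ^ 2) * divergence (unitField B) (ξ t) -
          η * fderiv ℝ (gyroForm B) (ξ t) (deriv ξ t) (deriv ξ t) (deriv ξ t)) -
          1 / 2 * (V ^ 2 - h t ^ 2) * divergence (unitField B) (x t) =
          (-(1 / 2 * (u t + h t)) * (u t - h t)) * divergence (unitField B) (ξ t) +
          1 / 2 * (V ^ 2 - h t ^ 2) *
            (divergence (unitField B) (ξ t) - divergence (unitField B) (x t)) -
          η * fderiv ℝ (gyroForm B) (ξ t) (deriv ξ t) (deriv ξ t) (deriv ξ t) := by ring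
      change ‖(1 / 2 * (V ^ 2 - u t ^ 2) * divergence (unitField B) (ξ t) -
          η * fderiv ℝ (gyroForm B) (ξ t) (deriv ξ t) (deriv ξ t) (deriv ξ t)) -
          1 / 2 * (V ^ 2 - h t ^ 2) * divergence (unitField B) (x t)‖ ≤ _
      rw [hsplit]
      have hh2 : h t ^ 2 ≤ V ^ 2 := sq_le_sq.2 (by rw [abs_of_nonneg hV]; exact hhV t)
      refine (norm_sub_le _ _).trans (add_le_add ((norm_add_le _ _).trans (add_le_add ?_ ?_)) ?_)
      · rw [norm_mul, norm_mul]
        refine mul_le_mul (mul_le_mul ?_ hU (norm_nonneg _) hV) hg (norm_nonneg _) (by positivity)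
        rw [Real.norm_eq_abs, abs_neg, abs_mul, abs_of_nonneg (by norm_num : (0 : ℝ) ≤ 1 / 2)]
        have := (abs_add_le (u t) (h t)).trans (add_le_add (huV t) (hhV t))
        linarith
      · rw [norm_mul, Real.norm_of_nonneg (by nlinarith)]
        refine mul_le_mul ?_ (hgd.trans (mul_le_mul_of_nonneg_left hX hD0)) (norm_nonneg _)
          (by positivity)
        nlinarith [sq_nonneg (h t)]
      · rw [norm_mul, Real.norm_of_nonneg hη]
        refine mul_le_mul_of_nonneg_left ((ContinuousLinearMap.le_opNorm₂ _ _ _).trans ?_) hη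
        rw [hv]
        gcongr
        exact (ContinuousLinearMap.le_opNorm _ _).trans (by rw [hv]; gcongr)

end Estimate

/-! ### From a uniform rate to Hölder convergence. -/

section Holder

/-- Interpolation between a uniform bound and a Lipschitz bound. -/
theorem holderNormOn_le_of_lipschitz {f : ℝ → E3} {T : ℝ} {α ε L : ℝ≥0} (hα : α ≤ 1)
    (hf : ∀ s ∈ Icc 0 T, ‖f s‖ ≤ ε) (hL : ∀ s ∈ Icc 0 T, ∀ t ∈ Icc 0 T,
      ‖f s - f t‖ ≤ L * |s - t|) :
    holderNormOn α T f ≤ ((ε + (2 * ε) ^ (1 - α : ℝ) * L ^ (α : ℝ) : ℝ≥0) : ℝ≥0∞) := by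
  rw [ENNReal.coe_add, holderNormOn]
  refine add_le_add (iSup_le fun t => ?_) (HolderWith.eHolderNorm_le fun s t => ?_)
  · have : ‖f t‖₊ ≤ ε := hf t t.2
    exact_mod_cast this
  · have h1 : nndist (f s) (f t) ≤ 2 * ε := by
      rw [← NNReal.coe_le_coe, coe_nndist, dist_eq_norm]
      refine (norm_sub_le _ _).trans ?_
      have := hf s s.2
      have := hf t t.2
      push_cast
      linarith
    have h2 : nndist (f s) (f t) ≤ L * nndist s t := by
      rw [← NNReal.coe_le_coe, coe_nndist, dist_eq_norm]
      exact hL s s.2 t t.2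
    have hα' : (0 : ℝ) ≤ 1 - α := sub_nonneg.2 (by exact_mod_cast hα)
    have h3 : nndist (f s) (f t) ≤
        (2 * ε) ^ (1 - α : ℝ) * L ^ (α : ℝ) * nndist s t ^ (α : ℝ) :=
      calc nndist (f s) (f t) = nndist (f s) (f t) ^ (1 - α : ℝ) * nndist (f s) (f t) ^ (α : ℝ) := by
            rw [← NNReal.rpow_add_of_nonneg _ hα' α.coe_nonneg, sub_add_cancel, NNReal.rpow_one]
        _ ≤ (2 * ε) ^ (1 - α : ℝ) * (L * nndist s t) ^ (α : ℝ) :=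
            mul_le_mul' (NNReal.rpow_le_rpow h1 hα') (NNReal.rpow_le_rpow h2 α.coe_nonneg)
        _ = _ := by simp only [NNReal.mul_rpow]; ring
    rw [edist_nndist, edist_nndist, ← ENNReal.coe_rpow_of_nonneg _ α.coe_nonneg]
    exact_mod_cast h3

/-- Interpolation leaves the factor (2M/ω)^(1-α), which vanishes in the limit because α < 1. -/
theorem tendstoHolderLoc_of_rate {α : ℝ≥0} (hα : α < 1) {X : ℝ → ℝ → E3} {x : ℝ → E3} {L : ℝ≥0}
    (hrate : ∀ T : ℝ, 0 < T → ∃ M : ℝ, ∀ ω : ℝ, 0 < ω → ∀ t ∈ Icc 0 T, ‖X ω t - x t‖ ≤ M / ω)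
    (hL : ∀ ω : ℝ, 0 < ω → ∀ s t, ‖(X ω s - x s) - (X ω t - x t)‖ ≤ L * |s - t|) :
    TendstoHolderLoc α X x := by
  intro T hT
  obtain ⟨M, hM⟩ := hrate T hT
  have hα' : (0 : ℝ) < 1 - α := sub_pos.2 (by exact_mod_cast hα)
  have h1 : Tendsto (fun ω : ℝ => (M / ω).toNNReal) atTop (𝓝 0) := by
    have := (continuous_real_toNNReal.tendsto 0).comp (tendsto_const_nhds.div_atTop tendsto_id :
      Tendsto (fun ω : ℝ => M / ω) atTop (𝓝 0))
    simpa [Function.comp_def] using this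
  have hc : Continuous fun e : ℝ≥0 => e + (2 * e) ^ (1 - α : ℝ) * L ^ (α : ℝ) :=
    continuous_id.add (((NNReal.continuous_rpow_const hα'.le).comp
      (continuous_const.mul continuous_id)).mul continuous_const)
  have h2 := (hc.tendsto 0).comp h1
  simp only [Function.comp_def, mul_zero, NNReal.zero_rpow hα'.ne', zero_mul, add_zero] at h2
  have h3 : Tendsto (fun ω : ℝ => (((M / ω).toNNReal + (2 * (M / ω).toNNReal) ^ (1 - α : ℝ) *
      L ^ (α : ℝ) : ℝ≥0) : ℝ≥0∞)) atTop (𝓝 0) := by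
    rw [← ENNReal.coe_zero]
    exact ENNReal.tendsto_coe.2 h2
  refine tendsto_of_tendsto_of_tendsto_of_le_of_le' tendsto_const_nhds h3
    (Eventually.of_forall fun _ => zero_le) ?_
  filter_upwards [eventually_gt_atTop 0] with ω hω
  exact holderNormOn_le_of_lipschitz hα.le
    (fun s hs => (hM ω hω s hs).trans (Real.le_coe_toNNReal _)) (fun s _ t _ => hL ω hω s t)

end Holder

/-! ### Bounds on the weight and growth in time. -/

section Growth

variable {B : E3 → E3}

theorem exists_fieldWeight_le (hB : Continuous B) (hB0 : ∀ y, B y ≠ 0) (x₀ : E3) (r : ℝ) :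
    ∃ β, 1 ≤ β ∧ ∀ y, ‖y - x₀‖ ≤ r → fieldWeight B y ≤ β := by
  have hc : Continuous (fieldWeight B) :=
    continuous_const.add (hB.norm.inv₀ fun y => norm_ne_zero_iff.2 (hB0 y))
  obtain ⟨β, hβ⟩ := (isCompact_closedBall x₀ r).bddAbove_image hc.continuousOn
  exact ⟨max 1 β, le_max_left _ _, fun y hy =>
    (hβ (mem_image_of_mem _ (mem_closedBall_iff_norm.2 hy))).trans (le_max_right _ _)⟩

/-- Under minimal growth, the weight is polynomially bounded along the cone reached with
speed `V`. -/
theorem LorentzLimit.HasMinimalGrowth.fieldWeight_le {γ : ℝ} (hg : HasMinimalGrowth B γ)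
    (hγ : 0 ≤ γ) (hB : Continuous B) (hB0 : ∀ y, B y ≠ 0) (x₀ : E3) {V : ℝ} (hV : 0 ≤ V) :
    ∃ (A : ℝ) (n : ℕ), 1 ≤ A ∧ ∀ T, 0 ≤ T → ∀ y, ‖y - x₀‖ ≤ V * T →
      fieldWeight B y ≤ A * (1 + T) ^ n := by
  obtain ⟨R, c, hR, hc, hgr⟩ := hg
  obtain ⟨β, hβ, hβR⟩ := exists_fieldWeight_le hB hB0 0 R
  set a : ℝ := 1 + ‖x₀‖ + V
  have ha : 1 ≤ a := by have := norm_nonneg x₀; linarith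
  -- Rounding γ up is harmless as the base a (1 + T) is at least 1, and it makes the bound
  -- polynomial.
  set n := ⌈γ⌉₊
  refine ⟨β + a ^ n / c, n, by have : 0 ≤ a ^ n / c := by positivity
                               linarith, fun T hT y hy => ?_⟩
  have hT1 : 1 ≤ (1 + T) ^ n := one_le_pow₀ (by linarith)
  have hac : 0 ≤ a ^ n / c := by positivity
  rcases le_total ‖y‖ R with hyR | hyR
  · refine (hβR y (by simpa using hyR)).trans ?_
    nlinarith
  · have hy0 : 0 < ‖y‖ := hR.trans_le hyR
    have hyγ : 0 < ‖y‖ ^ γ := Real.rpow_pos_of_pos hy0 γ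
    have h1 : ‖B y‖⁻¹ ≤ ‖y‖ ^ γ / c := by
      have := inv_anti₀ (by positivity) (hgr y hyR)
      rwa [inv_div] at this
    have h2 : ‖y‖ ≤ a * (1 + T) := by
      have h3 : ‖y‖ ≤ ‖y - x₀‖ + ‖x₀‖ := by simpa using norm_add_le (y - x₀) x₀
      have := norm_nonneg x₀
      have : 0 ≤ ‖x₀‖ * T := by positivity
      have : a * (1 + T) = 1 + ‖x₀‖ + V + T + ‖x₀‖ * T + V * T := by simp only [a]; ring
      linarith
    have h4 : 1 ≤ a * (1 + T) := one_le_mul_of_one_le_of_one_le ha (by linarith)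
    have h5 : ‖y‖ ^ γ ≤ (a * (1 + T)) ^ n := by
      calc ‖y‖ ^ γ ≤ (a * (1 + T)) ^ γ := Real.rpow_le_rpow hy0.le h2 hγ
        _ ≤ (a * (1 + T)) ^ (n : ℝ) := Real.rpow_le_rpow_of_exponent_le h4 (Nat.le_ceil γ)
        _ = _ := Real.rpow_natCast _ _
    calc fieldWeight B y ≤ 1 + (a * (1 + T)) ^ n / c := by
          refine add_le_add le_rfl (h1.trans ?_)
          gcongr
      _ = 1 + a ^ n / c * (1 + T) ^ n := by rw [mul_pow]; ring
      _ ≤ _ := by rw [add_mul]; nlinarith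

/-- Polynomial and single exponential growth is dominated by double exponential growth. -/
theorem mul_exp_le_double_exp {Q : ℝ} (hQ : 1 ≤ Q) (n : ℕ) {γ : ℝ} (hγ : 0 ≤ γ) :
    ∃ C, 0 < C ∧ ∀ T, 0 ≤ T → Q * (1 + T) ^ n * Real.exp (Q * (1 + T) ^ n * T) ≤
      C * Real.exp (C * Real.exp (C * T ^ (γ + 2))) := by
  set C : ℝ := Q * Real.exp (n + 1) + (n + 1)
  have hC1 : Q * Real.exp (n + 1) ≤ C := le_add_of_nonneg_right (by positivity)
  have hC2 : (n + 1 : ℝ) ≤ C := le_add_of_nonneg_left (by positivity)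
  have hC : 1 ≤ C := le_trans (by linarith [(Nat.cast_nonneg n : (0 : ℝ) ≤ n)]) hC2
  refine ⟨C, by linarith, fun T hT => ?_⟩
  -- Only γ + 2 ≥ 1 matters here: it replaces T in the inner exponent at the cost of a constant
  -- factor.
  have hTγ : T ≤ 1 + T ^ (γ + 2) := by
    rcases le_total T 1 with h | h
    · have := Real.rpow_nonneg hT (γ + 2)
      linarith
    · have := Real.rpow_le_rpow_of_exponent_le h (by linarith : (1 : ℝ) ≤ γ + 2)
      rw [Real.rpow_one] at this
      linarith
  have hexp : 1 + T ≤ Real.exp T := by linarith [Real.add_one_le_exp T]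
  have hD : Q * (1 + T) ^ n ≤ Real.exp (Q * (1 + T) ^ n) := by
    linarith [Real.add_one_le_exp (Q * (1 + T) ^ n)]
  calc Q * (1 + T) ^ n * Real.exp (Q * (1 + T) ^ n * T)
      ≤ Real.exp (Q * (1 + T) ^ n) * Real.exp (Q * (1 + T) ^ n * T) := by gcongr
    _ = Real.exp (Q * (1 + T) ^ (n + 1)) := by rw [← Real.exp_add]; ring_nf
    _ ≤ Real.exp (C * Real.exp (C * T ^ (γ + 2))) := by
        refine Real.exp_le_exp.2 ?_
        calc Q * (1 + T) ^ (n + 1) ≤ Q * Real.exp T ^ (n + 1) := by gcongr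
          _ = Q * Real.exp ((n + 1) * T) := by rw [← Real.exp_nat_mul]; push_cast; rfl
          _ ≤ Q * Real.exp ((n + 1) * (1 + T ^ (γ + 2))) := by gcongr
          _ = Q * Real.exp (n + 1) * Real.exp ((n + 1) * T ^ (γ + 2)) := by
              rw [mul_assoc, ← Real.exp_add]; ring_nf
          _ ≤ _ := by
              have := Real.rpow_nonneg hT (γ + 2)
              gcongr
    _ ≤ _ := le_mul_of_one_le_left (Real.exp_pos _).le hC

end Growth

/-! ### The main theorem. -/

theorem theorem1p2 (B : E3 → E3) (hB : BoundedCk 2 B) (hB0 : ∀ y : E3, B y ≠ 0)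
    (hdiv : ∀ y : E3, divergence B y = 0) (x₀ v₀ : E3) :
    (∀ ω : ℝ, 0 < ω → ∃! ξ : ℝ → E3, IsLorentzSolution B ω x₀ v₀ ξ) ∧
    ∀ X : ℝ → ℝ → E3, (∀ ω : ℝ, 0 < ω → IsLorentzSolution B ω x₀ v₀ (X ω)) →
      ∃ x : ℝ → E3,
        ContDiff ℝ 3 x ∧
        (∀ α : ℝ≥0, α < 1 → TendstoHolderLoc α X x) ∧
        (∃ h : ℝ → ℝ, ContDiff ℝ 2 h ∧
          ∀ t : ℝ, HasDerivAt x (h t • unitField B (x t)) t) ∧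
        (∀ γ : ℝ, 0 ≤ γ → HasMinimalGrowth B γ →
          ∃ C : ℝ, 0 < C ∧ ∀ ω : ℝ, 0 < ω → ∀ t : ℝ, 0 ≤ t → ∀ s ∈ Icc (0 : ℝ) t,
            ‖X ω s - x s‖ ≤ C * (Real.exp (C * Real.exp (C * t ^ (γ + 2))) / ω)) ∧
        (∀ k : ℕ, ContDiff ℝ k B → ContDiff ℝ (k + 1) x) ∧
        (AnalyticOnNhd ℝ B univ → AnalyticOnNhd ℝ x univ) := by
  have hB1 : ContDiff ℝ 1 B := hB.1.of_le (by norm_num)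
  refine ⟨fun ω _ => existsUnique_lorentzSolution hB1 ω x₀ v₀, fun X hX => ?_⟩
  obtain ⟨x, h, hx0, hh0, hx, hh, hhV, hxV, hreg, han⟩ :=
    exists_averaged_solution hB0 hB.1 x₀ v₀
  obtain ⟨C, p, hC, hest⟩ := exists_rate_estimate hB hB0 x₀ v₀
  have hV : 0 ≤ ‖v₀‖ := norm_nonneg v₀
  -- The averaged field gives x and h only the class C^(k+1), but x' = h b(x) does not involve div
  -- b, so x gains one more derivative.
  have hregx : ∀ k : ℕ, ContDiff ℝ (k + 1) B → ContDiff ℝ (k + 2) x := by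
    intro k hk
    obtain ⟨hxk, hhk⟩ := hreg k hk
    have hd : deriv x = fun t => h t • unitField B (x t) := funext fun t => (hx t).deriv
    have : ContDiff ℝ ((k + 1 : WithTop ℕ∞) + 1) x := by
      refine contDiff_succ_iff_deriv.2 ⟨fun t => (hx t).differentiableAt,
        fun h => absurd h (by exact_mod_cast WithTop.coe_ne_top), ?_⟩
      rw [hd]
      exact hhk.smul ((contDiff_unitField hB0 hk le_rfl).comp hxk)
    rwa [add_assoc, one_add_one_eq_two] at this
  have h2 : ContDiff ℝ ((1 : ℕ) + 1) B := by
    rw [Nat.cast_one, one_add_one_eq_two]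
    exact hB.1
  have hx3 : ContDiff ℝ 3 x := by
    have := hregx 1 h2
    norm_num at this
    exact this
  refine ⟨x, hx3, fun α hα => ?_, ⟨h, ?_, hx⟩, fun γ hγ hg => ?_, fun k hk => ?_, han⟩
  -- Both curves have speed at most |v₀|, hence the Lipschitz constant 2 |v₀| for their difference.
  · refine tendstoHolderLoc_of_rate (L := 2 * ‖v₀‖₊) hα (fun T hT => ?_) fun ω hω s t => ?_
    · obtain ⟨β, hβ, hβT⟩ := exists_fieldWeight_le hB1.continuous hB0 x₀ (‖v₀‖ * T)
      exact ⟨_, fun ω hω t ht =>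
        hest T β hT.le hβ hβT x h hx0 hh0 hx hh hhV hxV ω (X ω) hω (hX ω hω) t ht⟩
    · have h1 : ‖x s - x t‖ ≤ ‖v₀‖ * |s - t| :=
        convex_univ.norm_image_sub_le_of_norm_hasDerivWithin_le
          (fun r _ => (hx r).hasDerivWithinAt) (fun r _ => by
            rw [norm_smul, norm_unitField hB0, mul_one]
            exact hhV r) (mem_univ t) (mem_univ s)
      have h3 := (hX ω hω).norm_sub_le s t
      rw [sub_sub_sub_comm]
      refine (norm_sub_le _ _).trans ?_
      push_cast
      linarith
  · have := (hreg 1 h2).2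
    rwa [Nat.cast_one, one_add_one_eq_two] at this
  · obtain ⟨A, n, hA, hAn⟩ := hg.fieldWeight_le hγ hB1.continuous hB0 x₀ hV
    obtain ⟨C', hC', hexp⟩ := mul_exp_le_double_exp
      (one_le_mul_of_one_le_of_one_le hC (one_le_pow₀ hA : 1 ≤ A ^ p)) (n * p) hγ
    refine ⟨C', hC', fun ω hω t ht s hs => ?_⟩
    have h1 : 1 ≤ A * (1 + t) ^ n :=
      one_le_mul_of_one_le_of_one_le hA (one_le_pow₀ (by linarith))
    have h3 := hest t _ ht h1 (hAn t ht) x h hx0 hh0 hx hh hhV hxV ω (X ω) hω (hX ω hω) s hs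
    refine h3.trans ?_
    rw [← mul_div_assoc]
    refine div_le_div_of_nonneg_right ?_ hω.le
    have h4 : C * (A * (1 + t) ^ n) ^ p = C * A ^ p * (1 + t) ^ (n * p) := by
      rw [mul_pow, pow_mul]; ring
    rw [h4]
    exact hexp t ht
  -- For k = 0 the bootstrap does not apply, but x is already C³.
  · rcases k with _ | k
    · exact hx3.of_le (by norm_num)
    · have := hregx k (by exact_mod_cast hk)
      refine this.of_le ?_
      push_cast
      rw [add_assoc, one_add_one_eq_two]
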